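/- **Proposition.** Write $D_x=-i\partial_x$, $D_y=-i\partial_y$ and $\langle t\rangle=(1+t^2)^{1/2}$. Let $s>1/2$ and $A_0,A_1>0$, and let $V:\mathbb R^2\to\mathbb R$ be such that $V$ and $\partial_xV$ exist and are continuous on $\mathbb R^2$ and $$\sup_{x,y}\langle x\rangle^{2s}|V(x,y)|\le A_0,\qquad \sup_{x,y}\langle x\rangle|\partial_xV(x,y)|\le A_1 .$$ Let $$H=(D_x+y)^2+D_y^2+x+V(x,y),$$ the self-adjoint operator in $L^2(\mathbb R^2)$ which is the closure of this differential operator on $C_0^\infty(\mathbb R^2)$, and $\langle H\rangle^{-\gamma}=(1+H^2)^{-\gamma/2}$. Let $F\in C_0^\infty(\mathbb R)$ satisfy $0\le F\le 1$, $F(t)=1$ for $|t|\le 1$ and $F(t)=0$ for $|t|\ge 2$, and put $F_c(t)=F(t/c)$ for $c>0$. Let $0<\gamma<1/2$. There is a constant $C$, depending only on $\gamma$, $F$, $s$, $A_0$, $A_1$, such that for all such $V$, all $\beta\in\mathbb R$ and all $0<\eta_0<1$ the operator $$|y-\beta|^{-\gamma}\,F_{\eta_0}(y-\beta)\,\langle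 x\rangle^{-\gamma/2}\,\langle H\rangle^{-\gamma}$$ is defined and bounded on all of $L^2(\mathbb R^2)$, with norm at most $C$. In particular the bound is independent of $\eta_0$ and $\beta$. -/

import Mathlib

open MeasureTheory

open scoped ContDiff

noncomputable section

/-- The Hilbert space `L²(ℝ²)` of complex-valued functions of `p = (x, y)`, Lebesgue measure. -/
abbrev L2Plane : Type := Lp ℂ 2 (volume : Measure (ℝ × ℝ))

/-- `⟨t⟩ = (1 + t²)^{1/2}` for a real number `t`. -/
def japaneseBracket (t : ℝ) : ℝ := Real.sqrt (1 + t ^ 2)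

/-- `D_x = -i ∂/∂x`, acting on functions on the plane. -/
def Dx (u : ℝ × ℝ → ℂ) : ℝ × ℝ → ℂ := fun p => -Complex.I * fderiv ℝ u p (1, 0)

/-- `D_y = -i ∂/∂y`, acting on functions on the plane. -/
def Dy (u : ℝ × ℝ → ℂ) : ℝ × ℝ → ℂ := fun p => -Complex.I * fderiv ℝ u p (0, 1)

/-- `D_x + y`, acting on functions on the plane. -/
def DxAddY (u : ℝ × ℝ → ℂ) : ℝ × ℝ → ℂ := fun p => Dx u p + (p.2 : ℂ) * u p

/-- The differential expression `(D_x + y)² + D_y² + x + V(x, y)`. -/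
def hamiltonianExpr (V : ℝ × ℝ → ℝ) (u : ℝ × ℝ → ℂ) : ℝ × ℝ → ℂ :=
  fun p => DxAddY (DxAddY u) p + Dy (Dy u) p + (p.1 : ℂ) * u p + (V p : ℂ) * u p

lemma contDiff_Dx {u : ℝ × ℝ → ℂ} (hu : ContDiff ℝ ∞ u) : ContDiff ℝ ∞ (Dx u) :=
  contDiff_const.mul ((hu.fderiv_right (m := ∞) le_rfl).clm_apply contDiff_const)

lemma contDiff_Dy {u : ℝ × ℝ → ℂ} (hu : ContDiff ℝ ∞ u) : ContDiff ℝ ∞ (Dy u) :=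
  contDiff_const.mul ((hu.fderiv_right (m := ∞) le_rfl).clm_apply contDiff_const)

lemma contDiff_DxAddY {u : ℝ × ℝ → ℂ} (hu : ContDiff ℝ ∞ u) : ContDiff ℝ ∞ (DxAddY u) :=
  (contDiff_Dx hu).add ((Complex.ofRealCLM.contDiff.comp contDiff_snd).mul hu)

lemma Dx_lin {u v : ℝ × ℝ → ℂ} (hu : ContDiff ℝ ∞ u) (hv : ContDiff ℝ ∞ v) (c : ℂ) :
    Dx (c • u + v) = c • Dx u + Dx v := by
  funext p
  have h1 := (hu.differentiable (by simp)) p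
  have h2 := (hv.differentiable (by simp)) p
  simp only [Dx, Pi.add_apply, Pi.smul_apply]
  rw [fderiv_add (h1.const_smul c) h2, fderiv_const_smul h1]
  simp
  ring

lemma Dy_lin {u v : ℝ × ℝ → ℂ} (hu : ContDiff ℝ ∞ u) (hv : ContDiff ℝ ∞ v) (c : ℂ) :
    Dy (c • u + v) = c • Dy u + Dy v := by
  funext p
  have h1 := (hu.differentiable (by simp)) p
  have h2 := (hv.differentiable (by simp)) p
  simp only [Dy, Pi.add_apply, Pi.smul_apply]
  rw [fderiv_add (h1.const_smul c) h2, fderiv_const_smul h1]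
  simp
  ring

lemma DxAddY_lin {u v : ℝ × ℝ → ℂ} (hu : ContDiff ℝ ∞ u) (hv : ContDiff ℝ ∞ v) (c : ℂ) :
    DxAddY (c • u + v) = c • DxAddY u + DxAddY v := by
  funext p
  simp only [DxAddY, Dx_lin hu hv, Pi.add_apply, Pi.smul_apply, smul_eq_mul]
  ring

lemma hamiltonianExpr_lin (V : ℝ × ℝ → ℝ) {u v : ℝ × ℝ → ℂ} (hu : ContDiff ℝ ∞ u)
    (hv : ContDiff ℝ ∞ v) (c : ℂ) :
    hamiltonianExpr V (c • u + v) = c • hamiltonianExpr V u + hamiltonianExpr V v := by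
  funext p
  simp only [hamiltonianExpr, DxAddY_lin hu hv, Dy_lin hu hv,
    DxAddY_lin (contDiff_DxAddY hu) (contDiff_DxAddY hv), Dy_lin (contDiff_Dy hu) (contDiff_Dy hv),
    Pi.add_apply, Pi.smul_apply, smul_eq_mul]
  ring

/-- The graph in `L²(ℝ²) × L²(ℝ²)` of `(D_x + y)² + D_y² + x + V` on `C_0^∞(ℝ²)`. -/
def hamiltonianMinGraph (V : ℝ × ℝ → ℝ) : Submodule ℂ (L2Plane × L2Plane) where
  carrier := {w | ∃ φ : ℝ × ℝ → ℂ, ContDiff ℝ ∞ φ ∧ HasCompactSupport φ ∧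
    (w.1 : ℝ × ℝ → ℂ) =ᵐ[volume] φ ∧ (w.2 : ℝ × ℝ → ℂ) =ᵐ[volume] hamiltonianExpr V φ}
  zero_mem' := by
    refine ⟨0, contDiff_const, HasCompactSupport.zero, Lp.coeFn_zero _ _ _, ?_⟩
    have h : hamiltonianExpr V 0 = 0 := by
      have := hamiltonianExpr_lin V (u := 0) (v := 0) contDiff_const contDiff_const 1
      simpa using this
    rw [h]
    exact Lp.coeFn_zero _ _ _
  add_mem' := by
    rintro w w' ⟨φ, h1, h2, h3, h4⟩ ⟨ψ, k1, k2, k3, k4⟩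
    refine ⟨φ + ψ, h1.add k1, h2.add k2, (Lp.coeFn_add _ _).trans (h3.add k3), ?_⟩
    have h := hamiltonianExpr_lin V h1 k1 1
    rw [one_smul, one_smul] at h
    rw [h]
    exact (Lp.coeFn_add _ _).trans (h4.add k4)
  smul_mem' := by
    rintro c w ⟨φ, h1, h2, h3, h4⟩
    refine ⟨c • φ, h1.const_smul c, h2.smul_left (f := fun _ => c),
      (Lp.coeFn_smul _ _).trans (h3.const_smul c), ?_⟩
    have h := hamiltonianExpr_lin V h1 (v := 0) contDiff_const c
    have h0 := hamiltonianExpr_lin V (u := 0) (v := 0) contDiff_const contDiff_const 1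
    have h00 : hamiltonianExpr V 0 = 0 := by simpa using h0
    rw [add_zero, h00, add_zero] at h
    rw [h]
    exact (Lp.coeFn_smul _ _).trans (h4.const_smul c)

/-- The Hamiltonian `H = (D_x + y)² + D_y² + x + V` in `L²(ℝ²)`: the closure of the differential
operator on `C_0^∞(ℝ²)`. For bounded real `V` this is the (unique) self-adjoint realization. -/
def hamiltonian (V : ℝ × ℝ → ℝ) : L2Plane →ₗ.[ℂ] L2Plane :=
  (hamiltonianMinGraph V).topologicalClosure.toLinearPMap

/-- `R` is the bounded inverse of `1 + A*A`, where `A*` is the adjoint of the densely defined closed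
operator `A`; for self-adjoint `A` this says `R = (1 + A²)⁻¹ = ⟨A⟩⁻²`. -/
def IsJapaneseInvSq {E : Type*} [NormedAddCommGroup E] [InnerProductSpace ℂ E] [CompleteSpace E]
    (A : E →ₗ.[ℂ] E) (R : E →L[ℂ] E) : Prop :=
  ∀ f : E, ∃ (h : R f ∈ A.domain) (h' : A ⟨R f, h⟩ ∈ A.adjoint.domain),
    R f + A.adjoint ⟨A ⟨R f, h⟩, h'⟩ = f

/-- `B = ⟨A⟩^{-γ} = ((1 + A²)⁻¹)^{γ/2}` for a self-adjoint operator `A`; the power `γ/2` of the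
positive bounded operator `(1 + A²)⁻¹` is taken in the continuous functional calculus. -/
def IsJapaneseNegPow {E : Type*} [NormedAddCommGroup E] [InnerProductSpace ℂ E] [CompleteSpace E]
    (A : E →ₗ.[ℂ] E) (γ : ℝ) (B : E →L[ℂ] E) : Prop :=
  ∃ R : E →L[ℂ] E, IsJapaneseInvSq A R ∧ B = R ^ (γ / 2)

/-- The class of potentials: `V` real, `V` and `∂_x V` continuous,
`⟨x⟩^{2s} |V| ≤ A₀` and `⟨x⟩ |∂_x V| ≤ A₁` on the plane. -/
structure IsPotential (s A₀ A₁ : ℝ) (V : ℝ × ℝ → ℝ) : Prop where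
  continuous : Continuous V
  differentiableAt_x : ∀ x y : ℝ, DifferentiableAt ℝ (fun t => V (t, y)) x
  continuous_deriv_x : Continuous fun p : ℝ × ℝ => deriv (fun t => V (t, p.2)) p.1
  bound : ∀ x y : ℝ, japaneseBracket x ^ (2 * s) * |V (x, y)| ≤ A₀
  bound_deriv_x : ∀ x y : ℝ, japaneseBracket x * |deriv (fun t => V (t, y)) x| ≤ A₁

/-- A smooth cut-off `F : ℝ → [0, 1]` with `F = 1` on `|t| ≤ 1` and `F = 0` on `|t| ≥ 2`. -/
structure IsCutoff (F : ℝ → ℝ) : Prop where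
  contDiff : ContDiff ℝ ∞ F
  nonneg : ∀ t, 0 ≤ F t
  le_one : ∀ t, F t ≤ 1
  eq_one : ∀ t, |t| ≤ 1 → F t = 1
  eq_zero : ∀ t, 2 ≤ |t| → F t = 0

/-- The weight `|y - β|^{-γ} F((y - β)/η) ⟨x⟩^{-γ/2}` at `p = (x, y)`. -/
def singularWeight (F : ℝ → ℝ) (γ β η : ℝ) (p : ℝ × ℝ) : ℝ :=
  |p.2 - β| ^ (-γ) * F ((p.2 - β) / η) * japaneseBracket p.1 ^ (-(γ / 2))

end

/-! Put `ρ = |y - β| ⟨x⟩^{1/2}`. Since `0 ≤ F ≤ 1`, the weight is at most `ρ^{-γ}`, so it suffices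
to bound `‖ρ^{-γ} ⟨H⟩^{-γ} u‖` by `C ‖u‖` uniformly in `β`; the scale `η₀` enters in no other way.
Cutting dyadically in `ρ`, this becomes a bound for `∑ 4^{jγ}` times the mass of `⟨H⟩^{-γ} u` on the
strip `ρ ≤ 2^{-j}`.

Three facts carry the proof. (1) Pairing `Hφ` with `⟨x⟩⁻¹ φ` makes the unbounded term `x` harmless
and gives `∫ ⟨x⟩⁻¹ |D_y φ|² ≤ C (‖Hφ‖² + ‖φ‖²)` (`integral_weight_Dy_sq_le`). (2) On each line `x =
const`, comparing `g(y)` with `g(2y)` shows that halving the width of a strip halves the mass up to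
a factor `1 + ε`, with an error `δ² ∫ ⟨x⟩⁻¹ |D_y φ|²` (`integral_indicator_le_dilation`,
`setIntegral_stripRegion_le`). (3) `⟨H⟩^{-γ} u` has a quadratic real-interpolation decomposition
between `L²` and the domain of `H`: at scale `j` it is `v j + w j`, with `∑ 4^{jγ} (‖w j‖² + 4^{-j}
(‖v j‖² + ‖H v j‖²)) ≤ C ‖u‖²` (`exists_isJapaneseNegPow_decomposition`).

Using the `j`-th splitting at strip width `2^{-j}`, the weighted masses satisfy `a (j+1) ≤ q a j + D
b (j+1)` with `b` summable and `q` close to `4^γ / 2`. The condition `γ < 1/2` is exactly what makes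
`q < 1` possible, and the recursion then sums. -/

open scoped InnerProductSpace ComplexConjugate

/-! ### Negative powers of `⟨A⟩` and their dyadic decomposition. -/

section AbstractOperator

variable {E : Type*} [NormedAddCommGroup E] [InnerProductSpace ℂ E] [CompleteSpace E]

/-- Von Neumann's theorem: for the densely defined closed operator `A` with graph `G`, the operator
`1 + A*A` has a bounded positive inverse `R`, and `⟪R g, g⟫ = ‖R g‖² + ‖A R g‖²`. -/
lemma exists_isJapaneseInvSq (G : Submodule ℂ (E × E)) (hG : IsClosed (G : Set (E × E)))
    (hgraph : ∀ w ∈ G, w.1 = 0 → w.2 = 0)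
    (hdense : Dense (G.toLinearPMap.domain : Set E)) :
    ∃ R : E →L[ℂ] E, 0 ≤ R ∧ IsJapaneseInvSq G.toLinearPMap R ∧
      ∀ g, ∃ w, (R g, w) ∈ G ∧ ‖R g‖ ^ 2 + ‖w‖ ^ 2 = (⟪R g, g⟫_ℂ).re := by
  -- The `L²` product norm makes the graph a Hilbert space. With `J` the first projection on it, `J
  -- J*` is the required inverse, and `J* g` is the pair `(R g, A R g)`.
  let e := WithLp.prodContinuousLinearEquiv 2 ℂ E E
  let G' : Submodule ℂ (WithLp 2 (E × E)) := G.comap (e : WithLp 2 (E × E) →ₗ[ℂ] E × E)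
  have hG' : IsClosed (G' : Set (WithLp 2 (E × E))) := hG.preimage e.continuous
  have : CompleteSpace G' := hG'.completeSpace_coe
  let J : G' →L[ℂ] E := (ContinuousLinearMap.fst ℂ E E ∘L (e : WithLp 2 (E × E) →L[ℂ] E × E)) ∘L
    G'.subtypeL
  let R : E →L[ℂ] E := J ∘L J.adjoint
  have hmem : ∀ w : G', ((w : WithLp 2 (E × E)).fst, (w : WithLp 2 (E × E)).snd) ∈ G :=
    fun w => w.2
  have hR : ∀ g, R g = (J.adjoint g : WithLp 2 (E × E)).fst := fun g => rfl
  have hpos : 0 ≤ R := by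
    rw [ContinuousLinearMap.nonneg_iff_isPositive]
    exact J.isPositive_self_comp_adjoint
  refine ⟨R, hpos, fun f => ?_, fun g => ⟨(J.adjoint g : WithLp 2 (E × E)).snd, hmem _, ?_⟩⟩
  · have h1 : (R f, (J.adjoint f : WithLp 2 (E × E)).snd) ∈ G := hmem _
    have hdom : R f ∈ G.toLinearPMap.domain := ⟨_, h1, rfl⟩
    have hval : G.toLinearPMap ⟨R f, hdom⟩ = (J.adjoint f : WithLp 2 (E × E)).snd := by
      have h2 := Submodule.mem_graph_toLinearPMap hgraph ⟨R f, hdom⟩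
      have h3 := G.sub_mem h2 h1
      exact sub_eq_zero.1 (hgraph _ h3 (by simp))
    -- The defining identity of `J*`, tested on `(x, A x)`; it says that `A R f` lies in the domain
    -- of `A*` and is sent to `f - R f`.
    have key : ∀ x : G.toLinearPMap.domain,
        ⟪f - R f, (x : E)⟫_ℂ = ⟪G.toLinearPMap ⟨R f, hdom⟩, G.toLinearPMap x⟫_ℂ := by
      intro x
      have h2 := Submodule.mem_graph_toLinearPMap hgraph x
      let w : G' := ⟨WithLp.toLp 2 ((x : E), G.toLinearPMap x), h2⟩
      have h3 : ⟪J.adjoint f, w⟫_ℂ = ⟪f, J w⟫_ℂ := ContinuousLinearMap.adjoint_inner_left _ _ _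
      rw [Submodule.coe_inner, WithLp.prod_inner_apply] at h3
      rw [hval, inner_sub_left]
      have h4 : ⟪f, J w⟫_ℂ = ⟪f, (x : E)⟫_ℂ := rfl
      rw [← h4, ← h3, hR]
      simp [w]
    have hdom' : G.toLinearPMap ⟨R f, hdom⟩ ∈ G.toLinearPMap.adjoint.domain :=
      LinearPMap.mem_adjoint_domain_of_exists _ ⟨f - R f, key⟩
    refine ⟨hdom, hdom', ?_⟩
    rw [LinearPMap.adjoint_apply_eq hdense ⟨_, hdom'⟩ key]
    simp
  · have h3 : ⟪J.adjoint g, J.adjoint g⟫_ℂ = ⟪J (J.adjoint g), g⟫_ℂ :=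
      (ContinuousLinearMap.adjoint_inner_right _ _ _)
    have h4 : ‖J.adjoint g‖ ^ 2 = (⟪R g, g⟫_ℂ).re :=
      (norm_sq_eq_re_inner (𝕜 := ℂ) (J.adjoint g)).trans (congrArg Complex.re h3)
    rw [← h4, Submodule.coe_norm, WithLp.prod_norm_sq_eq_of_L2, hR]

/-- The dyadic weight grows by `4^γ` per step while the strip mass shrinks by about `1/2`; this
inequality lets the second win. -/
lemma four_rpow_lt_two {γ : ℝ} (hγ : γ < 1 / 2) : (4 : ℝ) ^ γ < 2 := by
  calc (4 : ℝ) ^ γ < 4 ^ (1 / 2 : ℝ) := Real.rpow_lt_rpow_of_exponent_lt (by norm_num) hγ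
    _ = 2 := by
      rw [show (4 : ℝ) = 2 ^ (2 : ℝ) by norm_num, ← Real.rpow_mul (by norm_num)]
      norm_num

/-- `∑ z_j^γ / (1 + z_j)` over `z_j = 4^j k` is bounded uniformly in `k ≥ 0` when `γ < 1/2`. -/
lemma sum_rpow_div_one_add_le {γ : ℝ} (hγ₀ : 0 < γ) (hγ₁ : γ < 1 / 2) (J : ℕ) {k : ℝ}
    (hk : 0 ≤ k) :
    ∑ j ∈ Finset.range J, (4 ^ j * k) ^ γ / (1 + 4 ^ j * k) ≤ 9 / ((4 : ℝ) ^ γ - 1) := by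
  have h4 : 1 < (4 : ℝ) ^ γ := Real.one_lt_rpow (by norm_num) hγ₀
  have h42 : (4 : ℝ) ^ γ ≤ 2 := (four_rpow_lt_two hγ₁).le
  set c : ℝ := (4 : ℝ) ^ γ with hc
  -- Each term is dominated by an increment of the bounded function `z^γ / (1 + z^γ)` between `z`
  -- and `4z`, so the sum telescopes. The 9 comes from bounding both factors `1 + c t` and `1 + t`
  -- by `3 √(1 + z)`.
  have hstep : ∀ z : ℝ, 0 ≤ z → z ^ γ / (1 + z) ≤
      9 / (c - 1) * ((4 * z) ^ γ / (1 + (4 * z) ^ γ) - z ^ γ / (1 + z ^ γ)) := by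
    intro z hz
    rw [Real.mul_rpow (by norm_num) hz, ← hc]
    have hs0 : 0 ≤ z ^ γ := Real.rpow_nonneg hz _
    have hs : z ^ γ ≤ Real.sqrt (1 + z) := by
      rw [Real.sqrt_eq_rpow]
      exact (Real.rpow_le_rpow hz (by linarith) hγ₀.le).trans
        (Real.rpow_le_rpow_of_exponent_le (by linarith) hγ₁.le)
    have hq1 : 1 ≤ Real.sqrt (1 + z) := Real.one_le_sqrt.2 (by linarith)
    have hq := Real.sq_sqrt (show 0 ≤ 1 + z by linarith)
    set t := z ^ γ
    set q := Real.sqrt (1 + z)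
    have e : 9 / (c - 1) * (c * t / (1 + c * t) - t / (1 + t))
        = 9 * t / ((1 + c * t) * (1 + t)) := by
      have : c - 1 ≠ 0 := by linarith
      have : 1 + c * t ≠ 0 := by positivity
      have : 1 + t ≠ 0 := by positivity
      field_simp
      ring
    rw [e, div_le_div_iff₀ (by linarith) (by positivity)]
    have h1 : (1 + c * t) * (1 + t) ≤ 9 * (1 + z) := by
      calc (1 + c * t) * (1 + t) ≤ (3 * q) * (3 * q) := by
            gcongr
            · nlinarith
            · linarith
        _ = 9 * (1 + z) := by rw [← hq]; ring
    nlinarith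
  have htel : ∀ J : ℕ, ∑ j ∈ Finset.range J, (4 ^ j * k) ^ γ / (1 + 4 ^ j * k) ≤
      9 / (c - 1) * ((4 ^ J * k) ^ γ / (1 + (4 ^ J * k) ^ γ) - k ^ γ / (1 + k ^ γ)) := by
    intro J
    induction J with
    | zero => simp
    | succ J ih =>
      rw [Finset.sum_range_succ]
      have := hstep (4 ^ J * k) (by positivity)
      rw [← mul_assoc, ← pow_succ'] at this
      linarith [mul_sub (9 / (c - 1)) ((4 ^ (J+1) * k) ^ γ / (1 + (4 ^ (J+1) * k) ^ γ))
        ((4 ^ J * k) ^ γ / (1 + (4 ^ J * k) ^ γ)),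
        mul_sub (9 / (c - 1)) ((4 ^ (J+1) * k) ^ γ / (1 + (4 ^ (J+1) * k) ^ γ))
        (k ^ γ / (1 + k ^ γ)),
        mul_sub (9 / (c - 1)) ((4 ^ J * k) ^ γ / (1 + (4 ^ J * k) ^ γ)) (k ^ γ / (1 + k ^ γ))]
  refine (htel J).trans (mul_le_of_le_one_right ?_ ?_)
  · exact div_nonneg (by norm_num) (by linarith)
  · have h1 : (4 ^ J * k) ^ γ / (1 + (4 ^ J * k) ^ γ) ≤ 1 := by
      have : 0 ≤ (4 ^ J * k) ^ γ := by positivity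
      rw [div_le_one (by linarith)]
      linarith
    have h2 : 0 ≤ k ^ γ / (1 + k ^ γ) := by positivity
    linarith

/-- The quadratic decomposition of `R^{γ/2} f` on the scales `4^j`. -/
lemma exists_rpow_decomposition {γ : ℝ} (hγ₀ : 0 < γ) (hγ₁ : γ < 1 / 2) {R : E →L[ℂ] E}
    (hR : 0 ≤ R) (f : E) :
    ∃ g w : ℕ → E, (∀ j, (R ^ (γ / 2)) f = R (g j) + w j) ∧
      ∀ J, ∑ j ∈ Finset.range J, (4 : ℝ) ^ (j * γ) *
        (‖w j‖ ^ 2 + (4 : ℝ)⁻¹ ^ j * (⟪R (g j), g j⟫_ℂ).re) ≤ 9 / ((4 : ℝ) ^ γ - 1) * ‖f‖ ^ 2 := by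
  have hsa : IsSelfAdjoint R := IsSelfAdjoint.of_nonneg hR
  have hspec : ∀ k ∈ spectrum ℝ R, 0 ≤ k := fun k hk => spectrum_nonneg_of_nonneg hR hk
  -- The splitting `1 = 1 / (1 + 4^j k) + 4^j k / (1 + 4^j k)` applied to `k^{γ/2}`: the second part
  -- carries a factor `k`, hence lies in the range of `R`. The weighted squares of the two parts add
  -- up to `(4^j k)^γ / (1 + 4^j k)`.
  let wf : ℕ → ℝ → ℝ := fun j k => k ^ (γ / 2) / (1 + 4 ^ j * k)
  let gf : ℕ → ℝ → ℝ := fun j k => 4 ^ j * wf j k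
  have hγ2 : 0 ≤ γ / 2 := by linarith
  have hwc : ∀ j, ContinuousOn (wf j) (spectrum ℝ R) := fun j =>
    ContinuousOn.div (Real.continuous_rpow_const hγ2).continuousOn (by fun_prop)
      (fun k hk => by have := hspec k hk; positivity)
  have hgc : ∀ j, ContinuousOn (gf j) (spectrum ℝ R) := fun j => (hwc j).const_mul _
  have hinner : ∀ (a b : ℝ → ℝ), ContinuousOn a (spectrum ℝ R) → ContinuousOn b (spectrum ℝ R) →
      ⟪cfc a R f, cfc b R f⟫_ℂ = ⟪f, cfc (fun k => a k * b k) R f⟫_ℂ := by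
    intro a b ha hb
    rw [cfc_mul a b R ha hb]
    have h1 : IsSelfAdjoint (cfc a R) := cfc_predicate a R
    have h2 := h1.adjoint_eq
    conv_lhs => rw [← h2]
    rw [ContinuousLinearMap.adjoint_inner_left]
    rfl
  have hRg : ∀ j, R (cfc (gf j) R f) = cfc (fun k => k * gf j k) R f := by
    intro j
    rw [cfc_mul (fun k => k) (gf j) R continuousOn_id (hgc j), cfc_id' ℝ R]
    rfl
  refine ⟨fun j => cfc (gf j) R f, fun j => cfc (wf j) R f, fun j => ?_, fun J => ?_⟩
  · rw [hRg, CFC.rpow_eq_cfc_real hR, ← add_apply,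
      ← cfc_add (a := R) (fun k => k * gf j k) (wf j) (continuousOn_id.mul (hgc j)) (hwc j)]
    congr 1
    refine cfc_congr fun k hk => ?_
    have := hspec k hk
    simp only [gf, wf]
    field_simp
    ring
  · let sf : ℕ → ℝ → ℝ := fun j k => (4 ^ j * k) ^ γ / (1 + 4 ^ j * k)
    have hsc : ∀ j, ContinuousOn (sf j) (spectrum ℝ R) := fun j =>
      ContinuousOn.div ((Real.continuous_rpow_const hγ₀.le).comp (by fun_prop)).continuousOn
        (by fun_prop) (fun k hk => by have := hspec k hk; positivity)
    have hre : ∀ (c : ℝ) (x : E), (⟪f, c • x⟫_ℂ).re = c * (⟪f, x⟫_ℂ).re := by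
      intro c x
      rw [← Complex.coe_smul, inner_smul_right, Complex.re_ofReal_mul]
    have hterm : ∀ j : ℕ, (4 : ℝ) ^ (j * γ) * (‖cfc (wf j) R f‖ ^ 2 + (4 : ℝ)⁻¹ ^ j *
        (⟪R (cfc (gf j) R f), cfc (gf j) R f⟫_ℂ).re) = (⟪f, cfc (sf j) R f⟫_ℂ).re := by
      intro j
      rw [hRg, hinner (fun k => k * gf j k) (gf j) (continuousOn_id.mul (hgc j)) (hgc j)]
      have h1 : ‖cfc (wf j) R f‖ ^ 2 = (⟪f, cfc (fun k => wf j k * wf j k) R f⟫_ℂ).re := by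
        rw [← hinner _ _ (hwc j) (hwc j)]
        exact norm_sq_eq_re_inner (𝕜 := ℂ) _
      have h2 : cfc (sf j) R = ((4 : ℝ) ^ (j * γ)) • (cfc (fun k => wf j k * wf j k) R +
          ((4 : ℝ)⁻¹ ^ j) • cfc (fun k => k * gf j k * gf j k) R) := by
        have c1 : ContinuousOn (fun k => wf j k * wf j k) (spectrum ℝ R) := (hwc j).mul (hwc j)
        have c2 : ContinuousOn (fun k => k * gf j k * gf j k) (spectrum ℝ R) :=
          (continuousOn_id.mul (hgc j)).mul (hgc j)
        have c3 : ContinuousOn (fun k => (4 : ℝ)⁻¹ ^ j • (k * gf j k * gf j k)) (spectrum ℝ R) :=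
          c2.const_smul ((4 : ℝ)⁻¹ ^ j)
        have c4 : ContinuousOn (fun k => wf j k * wf j k + (4 : ℝ)⁻¹ ^ j • (k * gf j k * gf j k))
          (spectrum ℝ R) := c1.add c3
        rw [← cfc_smul _ _ R c2, ← cfc_add (a := R) _ _ c1 c3, ← cfc_smul _ _ R c4]
        refine cfc_congr fun k hk => ?_
        have hk0 := hspec k hk
        simp only [sf, gf, wf, smul_eq_mul]
        have e1 : (4 ^ j * k) ^ γ = (4 : ℝ) ^ (j * γ) * (k ^ (γ / 2) * k ^ (γ / 2)) := by
          rw [Real.mul_rpow (by positivity) hk0, Real.rpow_mul (by norm_num), Real.rpow_natCast,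
            ← Real.mul_rpow hk0 hk0, ← sq k, ← Real.rpow_natCast k 2, ← Real.rpow_mul hk0]
          congr 2
          push_cast
          ring
        rw [e1]
        have : (1 + 4 ^ j * k) ≠ 0 := by positivity
        rw [inv_pow]
        field_simp
      rw [h1, h2]
      rw [smul_apply, hre, add_apply, inner_add_right, Complex.add_re, smul_apply, hre]
    simp only [hterm]
    rw [← Complex.re_sum, ← inner_sum, ← sum_apply]
    have hle : ∑ j ∈ Finset.range J, cfc (sf j) R ≤
        algebraMap ℝ (E →L[ℂ] E) (9 / ((4 : ℝ) ^ γ - 1)) := by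
      rw [← cfc_sum (fun j => sf j) R (Finset.range J) (fun j _ => hsc j)]
      refine cfc_le_algebraMap _ _ _ (fun k hk => ?_) ?_
      · rw [Finset.sum_apply]
        exact sum_rpow_div_one_add_le hγ₀ hγ₁ J (hspec k hk)
      · exact ContinuousOn.congr (continuousOn_finsetSum _ fun j _ => hsc j)
          fun k _ => Finset.sum_apply _ _ _
    rw [ContinuousLinearMap.le_def] at hle
    have h := hle.re_inner_nonneg_right f
    rw [sub_apply, inner_sub_right, map_sub, Algebra.algebraMap_eq_smul_one, smul_apply] at h
    have h2 : RCLike.re ⟪f, (9 / ((4 : ℝ) ^ γ - 1)) • (1 : E →L[ℂ] E) f⟫_ℂ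
        = 9 / ((4 : ℝ) ^ γ - 1) * ‖f‖ ^ 2 :=
      (hre _ _).trans (congrArg _ (norm_sq_eq_re_inner (𝕜 := ℂ) f).symm)
    rw [h2] at h
    exact sub_nonneg.1 h

/-- For the densely defined closed operator `A` with graph `G`, the operator `⟨A⟩^{-γ}` exists, and
on the scale `4^j` each `⟨A⟩^{-γ} u` splits as `v j + w j` with `v j` in the domain of `A`, such
that the weighted square sum of the pieces is controlled. -/
lemma exists_isJapaneseNegPow_decomposition {γ : ℝ} (hγ₀ : 0 < γ) (hγ₁ : γ < 1 / 2)
    (G : Submodule ℂ (E × E)) (hG : IsClosed (G : Set (E × E)))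
    (hgraph : ∀ w ∈ G, w.1 = 0 → w.2 = 0)
    (hdense : Dense (G.toLinearPMap.domain : Set E)) :
    ∃ B : E →L[ℂ] E, IsJapaneseNegPow G.toLinearPMap γ B ∧
      ∀ u, ∃ v z w : ℕ → E, (∀ j, (v j, z j) ∈ G) ∧ (∀ j, B u = v j + w j) ∧
        ∀ J, ∑ j ∈ Finset.range J, (4 : ℝ) ^ (j * γ) *
          (‖w j‖ ^ 2 + (4 : ℝ)⁻¹ ^ j * (‖v j‖ ^ 2 + ‖z j‖ ^ 2)) ≤
            9 / ((4 : ℝ) ^ γ - 1) * ‖u‖ ^ 2 := by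
  obtain ⟨R, hR0, hRinv, hRg⟩ := exists_isJapaneseInvSq G hG hgraph hdense
  refine ⟨R ^ (γ / 2), ⟨R, hRinv, rfl⟩, fun u => ?_⟩
  obtain ⟨g, w, hdec, hsum⟩ := exists_rpow_decomposition hγ₀ hγ₁ hR0 u
  choose z hz hzn using fun j => hRg (g j)
  refine ⟨fun j => R (g j), z, w, hz, hdec, fun J => ?_⟩
  simp only [hzn]
  exact hsum J

end AbstractOperator

/-! ### Integration by parts and the weighted a priori estimate. -/

section DifferentialExpression

lemma one_le_japaneseBracket (t : ℝ) : 1 ≤ japaneseBracket t :=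
  Real.one_le_sqrt.2 (by nlinarith [sq_nonneg t])

lemma japaneseBracket_pos (t : ℝ) : 0 < japaneseBracket t :=
  zero_lt_one.trans_le (one_le_japaneseBracket t)

lemma abs_le_japaneseBracket (t : ℝ) : |t| ≤ japaneseBracket t :=
  Real.abs_le_sqrt (by linarith)

lemma contDiff_japaneseBracket : ContDiff ℝ ∞ japaneseBracket :=
  ContDiff.sqrt (by fun_prop) fun t => by positivity

lemma continuous_japaneseBracket : Continuous japaneseBracket :=
  contDiff_japaneseBracket.continuous

lemma contDiff_japaneseBracket_inv : ContDiff ℝ ∞ fun t => (japaneseBracket t)⁻¹ :=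
  contDiff_japaneseBracket.inv fun t => (japaneseBracket_pos t).ne'

/-- The derivative has size `|t| / ⟨t⟩³`, and `|t| ≤ ⟨t⟩²`. Thus the commutator of `D_x` with the
weight is controlled by the weight itself. -/
lemma abs_deriv_japaneseBracket_inv_le (t : ℝ) :
    |deriv (fun t => (japaneseBracket t)⁻¹) t| ≤ (japaneseBracket t)⁻¹ := by
  have h0 : (1 + t ^ 2) ≠ 0 := by positivity
  have h1 : HasDerivAt japaneseBracket (2 * t / (2 * Real.sqrt (1 + t ^ 2))) t := by
    have : HasDerivAt (fun t : ℝ => 1 + t ^ 2) (2 * t) t := by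
      simpa using (hasDerivAt_pow 2 t).const_add 1
    exact this.sqrt h0
  have hp := japaneseBracket_pos t
  have hsq : japaneseBracket t ^ 2 = 1 + t ^ 2 := Real.sq_sqrt (by positivity)
  rw [(h1.fun_inv hp.ne').deriv, abs_div, abs_neg, abs_div, abs_mul, abs_mul,
    show Real.sqrt (1 + t ^ 2) = japaneseBracket t from rfl, abs_of_pos hp, abs_pow,
    abs_of_pos hp, hsq, div_le_iff₀ (by positivity), abs_two]
  have : 2 * |t| / (2 * japaneseBracket t) = (japaneseBracket t)⁻¹ * |t| := by
    field_simp
  rw [this]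
  gcongr
  nlinarith [sq_abs t, sq_nonneg (|t| - 1), abs_nonneg t]

lemma IsPotential.abs_le {s A₀ A₁ : ℝ} (hs : 1 / 2 < s) {V : ℝ × ℝ → ℝ}
    (hV : IsPotential s A₀ A₁ V) (p : ℝ × ℝ) : |V p| ≤ A₀ := by
  refine le_trans ?_ (hV.bound p.1 p.2)
  exact le_mul_of_one_le_left (abs_nonneg _)
    (Real.one_le_rpow (one_le_japaneseBracket _) (by linarith))

variable {f g φ ψ : ℝ × ℝ → ℂ}

lemma integrable_mul_conj (hf : Continuous f) (hfc : HasCompactSupport f) (hg : Continuous g) :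
    Integrable (fun p => f p * conj (g p)) :=
  (hf.mul (Complex.continuous_conj.comp hg)).integrable_of_hasCompactSupport hfc.mul_right

lemma integrable_norm_sq (hf : Continuous f) (hfc : HasCompactSupport f) :
    Integrable fun p => ‖f p‖ ^ 2 := by
  simp only [sq]
  exact (hf.norm.mul hf.norm).integrable_of_hasCompactSupport hfc.norm.mul_left

/-- Integration by parts for `-i ∂_v`. -/
lemma integral_momentum_mul_conj (v : ℝ × ℝ) (hf : ContDiff ℝ ∞ f) (hfc : HasCompactSupport f)
    (hg : ContDiff ℝ ∞ g) :
    ∫ p, (-Complex.I * fderiv ℝ f p v) * conj (g p) =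
      ∫ p, f p * conj (-Complex.I * fderiv ℝ g p v) := by
  have hg' : ContDiff ℝ ∞ fun p => conj (g p) := Complex.conjCLE.contDiff.comp hg
  have hfd : ∀ p, fderiv ℝ (fun p => conj (g p)) p v = conj (fderiv ℝ g p v) := by
    intro p
    have h := Complex.conjCLE.toContinuousLinearMap.hasFDerivAt.comp p
      (hg.differentiable (by simp) p).hasFDerivAt
    have h2 : HasFDerivAt (fun p => conj (g p)) _ p := h
    rw [h2.fderiv]
    rfl
  have hf1 : Continuous fun p => fderiv ℝ f p v :=
    (hf.continuous_fderiv (by simp)).clm_apply continuous_const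
  have hg1 : Continuous fun p => fderiv ℝ (fun p => conj (g p)) p v :=
    (hg'.continuous_fderiv (by simp)).clm_apply continuous_const
  have key := integral_mul_fderiv_eq_neg_fderiv_mul_of_integrable (μ := (volume : Measure (ℝ × ℝ)))
    (f := f) (g := fun p => conj (g p)) (v := v)
    ((hf1.mul hg'.continuous).integrable_of_hasCompactSupport
      (hfc.fderiv_apply (𝕜 := ℝ) v).mul_right)
    ((hf.continuous.mul hg1).integrable_of_hasCompactSupport hfc.mul_right)
    ((hf.continuous.mul hg'.continuous).integrable_of_hasCompactSupport hfc.mul_right)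
    (fun p _ => hf.differentiable (by simp) p) (fun p _ => hg'.differentiable (by simp) p)
  simp only [hfd] at key
  have e1 : ∀ p, (-Complex.I * fderiv ℝ f p v) * conj (g p) =
      -Complex.I * (fderiv ℝ f p v * conj (g p)) := fun p => by ring
  have e2 : ∀ p, f p * conj (-Complex.I * fderiv ℝ g p v) =
      Complex.I * (f p * conj (fderiv ℝ g p v)) := fun p => by
    rw [map_mul, map_neg, Complex.conj_I]; ring
  simp only [e1, e2]
  rw [integral_const_mul, integral_const_mul, key]
  ring

lemma HasCompactSupport.Dx (hf : HasCompactSupport f) : HasCompactSupport (Dx f) :=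
  (hf.fderiv_apply (𝕜 := ℝ) (1, 0)).mul_left

lemma HasCompactSupport.Dy (hf : HasCompactSupport f) : HasCompactSupport (Dy f) :=
  (hf.fderiv_apply (𝕜 := ℝ) (0, 1)).mul_left

lemma HasCompactSupport.DxAddY (hf : HasCompactSupport f) : HasCompactSupport (DxAddY f) :=
  hf.Dx.add hf.mul_left

lemma continuous_hamiltonianExpr {V : ℝ × ℝ → ℝ} (hV : Continuous V) (hφ : ContDiff ℝ ∞ φ) :
    Continuous (hamiltonianExpr V φ) := by
  have h1 := (contDiff_DxAddY (contDiff_DxAddY hφ)).continuous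
  have h2 := (contDiff_Dy (contDiff_Dy hφ)).continuous
  have h3 := hφ.continuous
  unfold hamiltonianExpr
  fun_prop

lemma HasCompactSupport.hamiltonianExpr (V : ℝ × ℝ → ℝ) (hφ : HasCompactSupport φ) :
    HasCompactSupport (hamiltonianExpr V φ) :=
  ((hφ.DxAddY.DxAddY.add hφ.Dy.Dy).add hφ.mul_left).add hφ.mul_left

lemma integral_Dy_mul_conj (hf : ContDiff ℝ ∞ f) (hfc : HasCompactSupport f)
    (hg : ContDiff ℝ ∞ g) : ∫ p, Dy f p * conj (g p) = ∫ p, f p * conj (Dy g p) :=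
  integral_momentum_mul_conj (0, 1) hf hfc hg

lemma integral_DxAddY_mul_conj (hf : ContDiff ℝ ∞ f) (hfc : HasCompactSupport f)
    (hg : ContDiff ℝ ∞ g) : ∫ p, DxAddY f p * conj (g p) = ∫ p, f p * conj (DxAddY g p) := by
  have h1 : ∫ p, Dx f p * conj (g p) = ∫ p, f p * conj (Dx g p) :=
    integral_momentum_mul_conj (1, 0) hf hfc hg
  have e1 : ∀ p, DxAddY f p * conj (g p) =
      Dx f p * conj (g p) + f p * conj ((p.2 : ℂ) * g p) := fun p => by
    simp only [DxAddY, map_mul, Complex.conj_ofReal]; ring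
  have e2 : ∀ p, f p * conj (DxAddY g p) =
      f p * conj (Dx g p) + f p * conj ((p.2 : ℂ) * g p) := fun p => by
    simp only [DxAddY, map_add]; ring
  have i3 : Integrable fun p : ℝ × ℝ => f p * conj ((p.2 : ℂ) * g p) :=
    integrable_mul_conj hf.continuous hfc
      ((Complex.continuous_ofReal.comp continuous_snd).mul hg.continuous)
  simp only [e1, e2]
  rw [integral_add (integrable_mul_conj (contDiff_Dx hf).continuous hfc.Dx hg.continuous) i3,
    integral_add (integrable_mul_conj hf.continuous hfc (contDiff_Dx hg).continuous) i3, h1]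

/-- The sesquilinear form of the differential expression. -/
lemma integral_hamiltonianExpr_mul_conj {V : ℝ × ℝ → ℝ} (hV : Continuous V)
    (hφ : ContDiff ℝ ∞ φ) (hφc : HasCompactSupport φ) (hψ : ContDiff ℝ ∞ ψ) :
    ∫ p, hamiltonianExpr V φ p * conj (ψ p) =
      ∫ p, (DxAddY φ p * conj (DxAddY ψ p) + Dy φ p * conj (Dy ψ p) +
        ((p.1 + V p : ℝ) : ℂ) * φ p * conj (ψ p)) := by
  have cP := contDiff_DxAddY hφ
  have cD := contDiff_Dy hφ
  have e1 : ∀ p, hamiltonianExpr V φ p * conj (ψ p) =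
      DxAddY (DxAddY φ) p * conj (ψ p) + Dy (Dy φ) p * conj (ψ p) +
        ((p.1 + V p : ℝ) : ℂ) * φ p * conj (ψ p) := fun p => by
    simp only [hamiltonianExpr, Complex.ofReal_add]; ring
  have i1 := integrable_mul_conj (contDiff_DxAddY cP).continuous hφc.DxAddY.DxAddY hψ.continuous
  have i2 := integrable_mul_conj (contDiff_Dy cD).continuous hφc.Dy.Dy hψ.continuous
  have i3 : Integrable fun p : ℝ × ℝ => ((p.1 + V p : ℝ) : ℂ) * φ p * conj (ψ p) := by
    have h3 := hφ.continuous
    exact integrable_mul_conj (f := fun p => ((p.1 + V p : ℝ) : ℂ) * φ p)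
      (by fun_prop) hφc.mul_left hψ.continuous
  have j1 := integrable_mul_conj cP.continuous hφc.DxAddY (contDiff_DxAddY hψ).continuous
  have j2 := integrable_mul_conj cD.continuous hφc.Dy (contDiff_Dy hψ).continuous
  simp only [e1]
  rw [integral_add (i1.fun_add i2) i3, integral_add i1 i2, integral_add (j1.fun_add j2) i3,
    integral_add j1 j2, integral_DxAddY_mul_conj cP hφc.DxAddY hψ,
    integral_Dy_mul_conj cD hφc.Dy hψ]

/-- The differential expression is symmetric on test functions. -/
lemma integral_hamiltonianExpr_symm {V : ℝ × ℝ → ℝ} (hV : Continuous V)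
    (hφ : ContDiff ℝ ∞ φ) (hφc : HasCompactSupport φ) (hψ : ContDiff ℝ ∞ ψ)
    (hψc : HasCompactSupport ψ) :
    ∫ p, hamiltonianExpr V φ p * conj (ψ p) = ∫ p, φ p * conj (hamiltonianExpr V ψ p) := by
  have h1 := integral_hamiltonianExpr_mul_conj hV hφ hφc hψ
  have h2 := integral_hamiltonianExpr_mul_conj hV hψ hψc hφ
  have h3 : ∫ p, φ p * conj (hamiltonianExpr V ψ p) =
      conj (∫ p, hamiltonianExpr V ψ p * conj (φ p)) := by
    rw [← integral_conj]
    congr 1 with p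
    simp [mul_comm]
  rw [h1, h3, h2, ← integral_conj]
  congr 1 with p
  simp only [map_add, map_mul, Complex.conj_conj, Complex.conj_ofReal]
  ring

/-- Pointwise lower bound for the quadratic form with a weight `a` that varies slowly. -/
lemma le_re_weighted_form {a a' b M : ℝ} (ha0 : 0 ≤ a) (ha1 : a ≤ 1) (ha' : |a'| ≤ a)
    (hb : -M ≤ b * a) (P D z : ℂ) :
    a * ‖D‖ ^ 2 - (1 / 4 + M) * ‖z‖ ^ 2 ≤
      (P * conj ((a : ℂ) * P + -Complex.I * (a' : ℂ) * z) + D * conj ((a : ℂ) * D) +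
        (b : ℂ) * z * conj ((a : ℂ) * z)).re := by
  have hmc : ∀ z : ℂ, (z * conj z) = ((‖z‖ ^ 2 : ℝ) : ℂ) := fun z => by
    rw [Complex.mul_conj, Complex.normSq_eq_norm_sq]
  have e : P * conj ((a : ℂ) * P + -Complex.I * (a' : ℂ) * z) + D * conj ((a : ℂ) * D) +
        (b : ℂ) * z * conj ((a : ℂ) * z) =
      ((a * ‖P‖ ^ 2 + a * ‖D‖ ^ 2 + b * a * ‖z‖ ^ 2 : ℝ) : ℂ) +
        P * conj (-Complex.I * (a' : ℂ) * z) := by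
    simp only [map_add, map_mul, Complex.conj_ofReal, Complex.ofReal_add, Complex.ofReal_mul,
      ← hmc]
    ring
  rw [e, Complex.add_re, Complex.ofReal_re]
  have h1 := Complex.abs_re_le_norm (P * conj (-Complex.I * (a' : ℂ) * z))
  have h2 : ‖P * conj (-Complex.I * (a' : ℂ) * z)‖ ≤ a * (‖z‖ * ‖P‖) := by
    rw [norm_mul, Complex.norm_conj, norm_mul, norm_mul, norm_neg, Complex.norm_I,
      Complex.norm_real, one_mul, Real.norm_eq_abs]
    calc ‖P‖ * (|a'| * ‖z‖) = |a'| * (‖z‖ * ‖P‖) := by ring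
      _ ≤ _ := by gcongr
  have h3 := (abs_le.1 (h1.trans h2)).1
  -- Completing the square absorbs the commutator term into `a ‖P‖²`; this costs the `1/4`.
  have h4 := mul_nonneg ha0 (sq_nonneg (‖P‖ - ‖z‖ / 2))
  have h5 : a * ‖z‖ ^ 2 ≤ ‖z‖ ^ 2 := mul_le_of_le_one_left (by positivity) ha1
  have h6 := mul_le_mul_of_nonneg_right hb (sq_nonneg ‖z‖)
  linarith [show a * (‖P‖ - ‖z‖ / 2) ^ 2 = a * ‖P‖ ^ 2 - a * (‖z‖ * ‖P‖) + a * ‖z‖ ^ 2 / 4 by ring]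

/-- The a priori estimate `∫ ⟨x⟩⁻¹ |∂_y φ|² ≤ C (‖H φ‖² + ‖φ‖²)` on test functions. -/
lemma integral_weight_Dy_sq_le {V : ℝ × ℝ → ℝ} (hV : Continuous V) {A₀ : ℝ}
    (hVb : ∀ p, |V p| ≤ A₀) (hφ : ContDiff ℝ ∞ φ) (hφc : HasCompactSupport φ) :
    ∫ p : ℝ × ℝ, (japaneseBracket p.1)⁻¹ * ‖Dy φ p‖ ^ 2 ≤
      (2 + A₀) * ((∫ p, ‖hamiltonianExpr V φ p‖ ^ 2) + ∫ p, ‖φ p‖ ^ 2) := by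
  obtain ⟨a, hadef⟩ : ∃ a : ℝ → ℝ, a = fun t => (japaneseBracket t)⁻¹ := ⟨_, rfl⟩
  have ha : ContDiff ℝ ∞ a := hadef ▸ contDiff_japaneseBracket_inv
  have ha0 : ∀ t, 0 < a t := fun t => hadef ▸ inv_pos.2 (japaneseBracket_pos t)
  have ha1 : ∀ t, a t ≤ 1 := fun t => hadef ▸ inv_le_one_of_one_le₀ (one_le_japaneseBracket t)
  have hA0 : 0 ≤ A₀ := (abs_nonneg _).trans (hVb 0)
  have ha' : ∀ t, |deriv a t| ≤ a t := fun t => by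
    rw [hadef]
    exact abs_deriv_japaneseBracket_inv_le t
  have hat : ∀ t, |t * a t| ≤ 1 := fun t => by
    rw [abs_mul, abs_of_pos (ha0 _), hadef]
    simp only
    rw [← div_eq_mul_inv, div_le_one (japaneseBracket_pos _)]
    exact abs_le_japaneseBracket _
  -- The multiplier `⟨x⟩⁻¹ φ`. It depends on `x` only through the weight, so `D_y` commutes with it
  -- and only `D_x + y` produces a derivative of `a`.
  obtain ⟨ψ, hψdef⟩ : ∃ ψ : ℝ × ℝ → ℂ, ψ = fun p => (a p.1 : ℂ) * φ p := ⟨_, rfl⟩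
  have haC : ContDiff ℝ ∞ fun p : ℝ × ℝ => (a p.1 : ℂ) :=
    Complex.ofRealCLM.contDiff.comp (ha.comp contDiff_fst)
  have hψ : ContDiff ℝ ∞ ψ := hψdef ▸ haC.mul hφ
  have hψd : ∀ p v, fderiv ℝ ψ p v = (a p.1 : ℂ) * fderiv ℝ φ p v +
      ((deriv a p.1 * v.1 : ℝ) : ℂ) * φ p := by
    intro p v
    have h1 : HasFDerivAt (fun p : ℝ × ℝ => (a p.1 : ℂ))
        (Complex.ofRealCLM ∘L (deriv a p.1 • ContinuousLinearMap.fst ℝ ℝ ℝ)) p :=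
      Complex.ofRealCLM.hasFDerivAt.comp p
        (((ha.differentiable (by simp) p.1).hasDerivAt).comp_hasFDerivAt p hasFDerivAt_fst)
    have h2 := (hφ.differentiable (by simp) p).hasFDerivAt
    have h3 : HasFDerivAt ψ _ p := hψdef ▸ h1.fun_mul h2
    rw [h3.fderiv]
    simp
    ring
  have hkey := congrArg Complex.re (integral_hamiltonianExpr_mul_conj hV hφ hφc hψ)
  have i0 := integrable_mul_conj (continuous_hamiltonianExpr hV hφ) (hφc.hamiltonianExpr V)
    hψ.continuous
  have i1 : Integrable fun p : ℝ × ℝ => DxAddY φ p * conj (DxAddY ψ p) + Dy φ p * conj (Dy ψ p) +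
        ((p.1 + V p : ℝ) : ℂ) * φ p * conj (ψ p) := by
    have h3 := hφ.continuous
    exact ((integrable_mul_conj (contDiff_DxAddY hφ).continuous hφc.DxAddY
      (contDiff_DxAddY hψ).continuous).add
      (integrable_mul_conj (contDiff_Dy hφ).continuous hφc.Dy (contDiff_Dy hψ).continuous)).add
      (integrable_mul_conj (f := fun p => ((p.1 + V p : ℝ) : ℂ) * φ p)
      (by fun_prop) hφc.mul_left hψ.continuous)
  have hre0 := integral_re i0
  have hre1 := integral_re i1
  simp only [RCLike.re_to_complex] at hre0 hre1
  rw [← hre0, ← hre1] at hkey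
  have iφ := integrable_norm_sq hφ.continuous hφc
  have iH := integrable_norm_sq (continuous_hamiltonianExpr hV hφ) (hφc.hamiltonianExpr V)
  have hlow : ∀ p : ℝ × ℝ, (a p.1) * ‖Dy φ p‖ ^ 2 - (5 / 4 + A₀) * ‖φ p‖ ^ 2 ≤
      (DxAddY φ p * conj (DxAddY ψ p) + Dy φ p * conj (Dy ψ p) +
        ((p.1 + V p : ℝ) : ℂ) * φ p * conj (ψ p)).re := by
    intro p
    have hP : DxAddY ψ p = (a p.1 : ℂ) * DxAddY φ p +
        -Complex.I * ((deriv a p.1 : ℝ) : ℂ) * φ p := by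
      simp only [DxAddY, Dx, hψd, congrFun hψdef p]
      push_cast
      ring
    have hD : Dy ψ p = (a p.1 : ℂ) * Dy φ p := by
      simp only [Dy, hψd]
      push_cast
      ring
    have t4 : -(1 + A₀) ≤ (p.1 + V p) * a p.1 := by
      have h2 : |V p * a p.1| ≤ A₀ := by
        rw [abs_mul, abs_of_pos (ha0 _)]
        exact (mul_le_of_le_one_right (abs_nonneg _) (ha1 _)).trans (hVb p)
      have h1' := (abs_le.1 (hat p.1)).1
      have h2' := (abs_le.1 h2).1
      linarith
    have h := le_re_weighted_form (ha0 p.1).le (ha1 p.1) (ha' p.1) t4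
      (DxAddY φ p) (Dy φ p) (φ p)
    rw [hP, hD, congrFun hψdef p]
    linarith
  have hup : ∀ p : ℝ × ℝ, (hamiltonianExpr V φ p * conj (ψ p)).re ≤
      (1 / 2) * ‖hamiltonianExpr V φ p‖ ^ 2 + (1 / 2) * ‖φ p‖ ^ 2 := by
    intro p
    have h1 := Complex.re_le_norm (hamiltonianExpr V φ p * conj (ψ p))
    rw [norm_mul, Complex.norm_conj] at h1
    have h2 : ‖ψ p‖ ≤ ‖φ p‖ := by
      rw [hψdef, norm_mul, Complex.norm_real, Real.norm_eq_abs, abs_of_pos (ha0 _)]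
      exact mul_le_of_le_one_left (norm_nonneg _) (ha1 _)
    have h3 := mul_le_mul_of_nonneg_left h2 (norm_nonneg (hamiltonianExpr V φ p))
    have h4 := two_mul_le_add_sq ‖hamiltonianExpr V φ p‖ ‖φ p‖
    linarith
  have iD : Integrable fun p : ℝ × ℝ => a p.1 * ‖Dy φ p‖ ^ 2 := by
    have h1 := (contDiff_Dy hφ).continuous.norm
    simp only [sq]
    exact ((ha.continuous.comp continuous_fst).mul (h1.mul h1)).integrable_of_hasCompactSupport
      hφc.Dy.norm.mul_left.mul_left
  have m1 := integral_mono (iD.sub (iφ.const_mul _)) i1.re hlow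
  have m2 := integral_mono i0.re ((iH.const_mul _).add (iφ.const_mul _)) hup
  simp only [Pi.add_apply, Pi.sub_apply] at m1 m2
  rw [integral_sub iD (iφ.const_mul _), integral_const_mul] at m1
  rw [integral_add (iH.const_mul _) (iφ.const_mul _), integral_const_mul, integral_const_mul] at m2
  have p1 : 0 ≤ ∫ p, ‖hamiltonianExpr V φ p‖ ^ 2 := integral_nonneg fun p => by positivity
  have p2 : 0 ≤ ∫ p, ‖φ p‖ ^ 2 := integral_nonneg fun p => by positivity
  simp only [RCLike.re_to_complex] at m1 m2
  have hgoal : ∀ t, (japaneseBracket t)⁻¹ = a t := fun t => by rw [hadef]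
  simp only [hgoal]
  nlinarith [mul_nonneg hA0 p1, mul_nonneg hA0 p2]

end DifferentialExpression

/-! ### One variable: mass near a point and dilation by 2. -/

section OneDimensional

lemma sq_intervalIntegral_le {f : ℝ → ℝ} (hf : Continuous f) {a b : ℝ} (hab : a ≤ b) :
    (∫ t in a..b, f t) ^ 2 ≤ (b - a) * ∫ t in a..b, f t ^ 2 := by
  rcases hab.eq_or_lt with rfl | hlt
  · simp
  have hL : 0 < b - a := sub_pos.2 hlt
  set m := ∫ t in a..b, f t
  -- `c` is the mean of `f`; nonnegativity of the variance is the Cauchy–Schwarz inequality.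
  set c := m / (b - a)
  have h0 : 0 ≤ ∫ t in a..b, (f t - c) ^ 2 :=
    intervalIntegral.integral_nonneg hab fun t _ => sq_nonneg _
  have e : ∀ t, (f t - c) ^ 2 = f t ^ 2 - (2 * c) * f t + c ^ 2 := fun t => by ring
  simp only [e] at h0
  rw [intervalIntegral.integral_add, intervalIntegral.integral_sub,
    intervalIntegral.integral_const_mul, intervalIntegral.integral_const, smul_eq_mul] at h0
  · have hc : c * (b - a) = m := div_mul_cancel₀ _ hL.ne'
    change 0 ≤ (∫ t in a..b, f t ^ 2) - 2 * c * m + (b - a) * c ^ 2 at h0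
    nlinarith
  all_goals exact Continuous.intervalIntegrable (by fun_prop) _ _

lemma norm_sub_sq_le {g : ℝ → ℂ} (hg : ContDiff ℝ 1 g) (hgc : HasCompactSupport g) (a b : ℝ) :
    ‖g b - g a‖ ^ 2 ≤ |b - a| * ∫ y, ‖deriv g y‖ ^ 2 := by
  wlog hab : a ≤ b generalizing a b
  · rw [norm_sub_rev, abs_sub_comm]
    exact this b a (le_of_not_ge hab)
  have hd : Continuous (deriv g) := hg.continuous_deriv le_rfl
  have h1 : ∫ t in a..b, deriv g t = g b - g a :=
    intervalIntegral.integral_deriv_eq_sub (fun t _ => hg.differentiable one_ne_zero t)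
      (hd.intervalIntegrable _ _)
  have hi : Integrable fun y => ‖deriv g y‖ ^ 2 := by
    simp only [sq]
    exact (hd.norm.mul hd.norm).integrable_of_hasCompactSupport hgc.deriv.norm.mul_left
  rw [← h1, abs_of_nonneg (sub_nonneg.2 hab)]
  calc ‖∫ t in a..b, deriv g t‖ ^ 2 ≤ (∫ t in a..b, ‖deriv g t‖) ^ 2 := by
        gcongr
        exact intervalIntegral.norm_integral_le_integral_norm hab
    _ ≤ (b - a) * ∫ t in a..b, ‖deriv g t‖ ^ 2 := sq_intervalIntegral_le hd.norm hab
    _ ≤ (b - a) * ∫ y, ‖deriv g y‖ ^ 2 := by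
        have : 0 ≤ b - a := sub_nonneg.2 hab
        gcongr
        rw [intervalIntegral.integral_of_le hab]
        exact setIntegral_le_integral hi (Filter.Eventually.of_forall fun y => by positivity)

/-- Keeping the coefficient of `a ^ 2` close to 1 is essential: a crude factor 2 would destroy the
gain of `1/2` under dilation. -/
lemma add_sq_le_of_pos {ε : ℝ} (hε : 0 < ε) (a b : ℝ) :
    (a + b) ^ 2 ≤ (1 + ε) * a ^ 2 + (1 + ε⁻¹) * b ^ 2 := by
  have h : (1 + ε) * a ^ 2 + (1 + ε⁻¹) * b ^ 2 - (a + b) ^ 2 = ε * (a - ε⁻¹ * b) ^ 2 := by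
    field_simp
    ring
  have := mul_nonneg hε.le (sq_nonneg (a - ε⁻¹ * b))
  linarith

/-- Comparison of the mass of `g` near `0` at the scales `r` and `2 r`. -/
lemma integral_indicator_le_dilation {g : ℝ → ℂ} (hg : ContDiff ℝ 1 g)
    (hgc : HasCompactSupport g) {ε r : ℝ} (hε : 0 < ε) (hr : 0 ≤ r) :
    ∫ y, Set.indicator {y | |y| ≤ r} (fun y => ‖g y‖ ^ 2) y ≤
      (1 + ε) / 2 * (∫ y, Set.indicator {y | |y| ≤ 2 * r} (fun y => ‖g y‖ ^ 2) y) +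
        (1 + ε⁻¹) * (2 * r ^ 2) * ∫ y, ‖deriv g y‖ ^ 2 := by
  set K := ∫ y, ‖deriv g y‖ ^ 2
  have hK : 0 ≤ K := integral_nonneg fun y => by positivity
  have hms : ∀ r : ℝ, MeasurableSet {y : ℝ | |y| ≤ r} := fun r =>
    measurableSet_le (by fun_prop) (by fun_prop)
  have hi : Integrable fun y => ‖g y‖ ^ 2 := by
    simp only [sq]
    exact (hg.continuous.norm.mul hg.continuous.norm).integrable_of_hasCompactSupport
      hgc.norm.mul_left
  set h : ℝ → ℝ := Set.indicator {y | |y| ≤ 2 * r} (fun y => ‖g y‖ ^ 2)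
  have hh : Integrable h := hi.indicator (hms _)
  have hball : {y : ℝ | |y| ≤ r} = Metric.closedBall 0 r := by
    ext y
    simp
  have hconst : Integrable (Set.indicator {y : ℝ | |y| ≤ r} fun _ => r * K) := by
    rw [integrable_indicator_iff (hms r), hball]
    exact integrableOn_const measure_closedBall_lt_top.ne
  have hpt : ∀ y, Set.indicator {y | |y| ≤ r} (fun y => ‖g y‖ ^ 2) y ≤
      (1 + ε) * h (2 * y) + (1 + ε⁻¹) * Set.indicator {y : ℝ | |y| ≤ r} (fun _ => r * K) y := by
    intro y
    by_cases hy : |y| ≤ r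
    · have hy2 : |2 * y| ≤ 2 * r := by
        rw [abs_mul, abs_two]
        linarith
      simp only [h]
      rw [Set.indicator_of_mem (by exact hy), Set.indicator_of_mem (by exact hy2),
        Set.indicator_of_mem (by exact hy)]
      have h1 : ‖g y‖ ≤ ‖g (2 * y)‖ + ‖g (2 * y) - g y‖ := by
        rw [norm_sub_rev]
        exact norm_le_norm_add_norm_sub' _ _
      have h2 := norm_sub_sq_le hg hgc y (2 * y)
      have h3 : |2 * y - y| = |y| := by ring_nf
      rw [h3] at h2
      calc ‖g y‖ ^ 2 ≤ (‖g (2 * y)‖ + ‖g (2 * y) - g y‖) ^ 2 := by gcongr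
        _ ≤ (1 + ε) * ‖g (2 * y)‖ ^ 2 + (1 + ε⁻¹) * ‖g (2 * y) - g y‖ ^ 2 :=
          add_sq_le_of_pos hε _ _
        _ ≤ _ := by
          gcongr
          exact h2.trans (by gcongr)
    · rw [Set.indicator_of_notMem (by exact hy), Set.indicator_of_notMem (by exact hy)]
      have : 0 ≤ h (2 * y) := Set.indicator_nonneg (fun y _ => by positivity) _
      simp only [mul_zero, add_zero]
      positivity
  -- The substitution `y ↦ 2y` yields the gain `1/2`; the increment contributes `r K` on an interval
  -- of length `2r`, hence `2 r² K`.
  have hh2 : Integrable fun y => h (2 * y) := hh.comp_mul_left' two_ne_zero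
  have m := integral_mono (hi.indicator (hms r))
    ((hh2.const_mul (1 + ε)).add (hconst.const_mul (1 + ε⁻¹))) hpt
  simp only [Pi.add_apply] at m
  rw [integral_add (hh2.const_mul (1 + ε)) (hconst.const_mul (1 + ε⁻¹)), integral_const_mul,
    integral_const_mul, Measure.integral_comp_mul_left,
    integral_indicator (f := fun _ => r * K) (hms r), setIntegral_const, hball,
    measureReal_def, Real.volume_closedBall,
    ENNReal.toReal_ofReal (by linarith)] at m
  rw [hball]
  refine m.trans (le_of_eq ?_)
  rw [abs_of_pos (by norm_num), smul_eq_mul, smul_eq_mul]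
  ring

end OneDimensional

/-! ### Thin strips in the plane. -/

section Plane

/-- The region `|y - β| ⟨x⟩^{1/2} ≤ δ`. -/
def stripRegion (β δ : ℝ) : Set (ℝ × ℝ) :=
  {p | |p.2 - β| ≤ δ * (Real.sqrt (japaneseBracket p.1))⁻¹}

lemma measurableSet_stripRegion (β δ : ℝ) : MeasurableSet (stripRegion β δ) := by
  have := continuous_japaneseBracket.measurable
  exact measurableSet_le (by fun_prop) (by fun_prop)

lemma setIntegral_stripRegion_le {φ : ℝ × ℝ → ℂ} (hφ : ContDiff ℝ ∞ φ)
    (hφc : HasCompactSupport φ) (β : ℝ) {ε δ : ℝ} (hε : 0 < ε) (hδ : 0 ≤ δ) :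
    ∫ p in stripRegion β δ, ‖φ p‖ ^ 2 ≤
      (1 + ε) / 2 * (∫ p in stripRegion β (2 * δ), ‖φ p‖ ^ 2) +
        (1 + ε⁻¹) * (2 * δ ^ 2) * ∫ p : ℝ × ℝ, (japaneseBracket p.1)⁻¹ * ‖Dy φ p‖ ^ 2 := by
  have iφ := integrable_norm_sq hφ.continuous hφc
  have iD : Integrable fun p : ℝ × ℝ => (japaneseBracket p.1)⁻¹ * ‖Dy φ p‖ ^ 2 := by
    have h1 := (contDiff_Dy hφ).continuous.norm
    simp only [sq]
    exact ((contDiff_japaneseBracket_inv.continuous.comp continuous_fst).mul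
      (h1.mul h1)).integrable_of_hasCompactSupport hφc.Dy.norm.mul_left.mul_left
  have i1 := iφ.indicator (measurableSet_stripRegion β δ)
  have i2 := iφ.indicator (measurableSet_stripRegion β (2 * δ))
  rw [← integral_indicator (measurableSet_stripRegion β δ),
    ← integral_indicator (measurableSet_stripRegion β (2 * δ))]
  rw [Measure.volume_eq_prod] at *
  rw [integral_prod _ i1, integral_prod _ i2, integral_prod _ iD, ← integral_const_mul,
    ← integral_const_mul, ← integral_add (i2.integral_prod_left.const_mul _)
      (iD.integral_prod_left.const_mul _)]
  refine integral_mono i1.integral_prod_left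
    ((i2.integral_prod_left.const_mul _).add (iD.integral_prod_left.const_mul _)) fun x => ?_
  -- On the slice at `x` the half-width is `r = δ ⟨x⟩^{-1/2}`, so the error `r²` supplies exactly
  -- the weight `⟨x⟩⁻¹` of the a priori estimate. Translating by `β` keeps the constants independent
  -- of `β`.
  let g : ℝ → ℂ := fun y => φ (x, y + β)
  have hg : ContDiff ℝ 1 g := (hφ.of_le (by exact_mod_cast le_top)).comp (by fun_prop)
  have hgc : HasCompactSupport g := by
    refine HasCompactSupport.intro (K := (fun p : ℝ × ℝ => p.2 - β) '' tsupport φ)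
      (IsCompact.image hφc (by fun_prop)) fun y hy => ?_
    by_contra h
    exact hy ⟨(x, y + β), subset_tsupport _ h, by simp⟩
  have hdg : ∀ y, ‖deriv g y‖ = ‖Dy φ (x, y + β)‖ := by
    intro y
    have h1 : HasDerivAt (fun y : ℝ => (x, y + β)) ((0 : ℝ), (1 : ℝ)) y :=
      (hasDerivAt_const y x).prodMk ((hasDerivAt_id y).add_const β)
    have h2 := ((hφ.differentiable (by simp) (x, y + β)).hasFDerivAt).comp_hasDerivAt y h1
    have h3 : HasDerivAt g _ y := h2
    rw [h3.deriv, Dy, norm_mul, norm_neg, Complex.norm_I, one_mul]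
  have hq : 0 < Real.sqrt (japaneseBracket x) := Real.sqrt_pos.2 (japaneseBracket_pos x)
  have key := integral_indicator_le_dilation hg hgc hε
    (mul_nonneg hδ (inv_nonneg.2 hq.le))
  simp only [hdg] at key
  have hshift : ∀ r : ℝ, ∫ y, Set.indicator {y | |y| ≤ r} (fun y => ‖g y‖ ^ 2) y =
      ∫ y, Set.indicator {y | |y - β| ≤ r} (fun y => ‖φ (x, y)‖ ^ 2) y := by
    intro r
    rw [← integral_add_right_eq_self
      (Set.indicator {y | |y - β| ≤ r} (fun y => ‖φ (x, y)‖ ^ 2)) β]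
    congr 1 with y
    by_cases h : |y| ≤ r
    · rw [Set.indicator_of_mem (by exact h), Set.indicator_of_mem (by simpa using h)]
    · rw [Set.indicator_of_notMem (by exact h), Set.indicator_of_notMem (by simpa using h)]
  have hslice : ∀ δ y, (stripRegion β δ).indicator (fun p => ‖φ p‖ ^ 2) (x, y) =
      Set.indicator {y | |y - β| ≤ δ * (Real.sqrt (japaneseBracket x))⁻¹}
        (fun y => ‖φ (x, y)‖ ^ 2) y := fun δ y => rfl
  rw [hshift, hshift, integral_add_right_eq_self (fun y => ‖Dy φ (x, y)‖ ^ 2) β] at key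
  simp only [hslice]
  rw [integral_const_mul]
  refine key.trans (le_of_eq ?_)
  rw [mul_pow, inv_pow, Real.sq_sqrt (japaneseBracket_pos x).le, mul_assoc 2 δ]
  ring

end Plane

/-! ### From test functions to the domain of the closed operator. -/

section Closure

lemma Lp_two_norm_sq {α : Type*} [MeasurableSpace α] {μ : Measure α} (f : Lp ℂ 2 μ) :
    ‖f‖ ^ 2 = ∫ a, ‖f a‖ ^ 2 ∂μ := by
  rw [norm_sq_eq_re_inner (𝕜 := ℂ), L2.inner_def]
  simp only [inner_self_eq_norm_sq_to_K]
  norm_cast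

lemma inner_eq_integral_mul_conj {u v : L2Plane} {f g : ℝ × ℝ → ℂ} (hu : u =ᵐ[volume] f)
    (hv : v =ᵐ[volume] g) : ⟪u, v⟫_ℂ = ∫ p, g p * conj (f p) := by
  rw [L2.inner_def]
  refine integral_congr_ae ?_
  filter_upwards [hu, hv] with p h1 h2
  rw [h1, h2, RCLike.inner_apply]

lemma norm_sq_eq_integral {u : L2Plane} {f : ℝ × ℝ → ℂ} (hu : u =ᵐ[volume] f) :
    ‖u‖ ^ 2 = ∫ p, ‖f p‖ ^ 2 := by
  rw [Lp_two_norm_sq]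
  refine integral_congr_ae ?_
  filter_upwards [hu] with p h
  rw [h]

/-- A square integrable function orthogonal to all test functions vanishes. -/
lemma eq_zero_of_forall_integral_test {w : L2Plane}
    (h : ∀ φ : ℝ × ℝ → ℂ, ContDiff ℝ ∞ φ → HasCompactSupport φ →
      ∫ p, w p * conj (φ p) = 0) : w = 0 := by
  refine Lp.ext ?_
  have h1 : ∀ᵐ p ∂(volume : Measure (ℝ × ℝ)), w p = 0 := by
    refine ae_eq_zero_of_integral_contDiff_smul_eq_zero
      ((Lp.memLp w).locallyIntegrable (by norm_num)) fun g hg hgc => ?_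
    rw [← h (fun p => (g p : ℂ)) (Complex.ofRealCLM.contDiff.comp hg)
      (hgc.comp_left (g := fun t : ℝ => (t : ℂ)) Complex.ofReal_zero)]
    congr 1 with p
    rw [Complex.conj_ofReal, Complex.real_smul, mul_comm]
  filter_upwards [h1, Lp.coeFn_zero ℂ 2 (volume : Measure (ℝ × ℝ))] with p h2 h3
  rw [h2, h3]
  rfl

lemma exists_mem_hamiltonianMinGraph {V : ℝ × ℝ → ℝ} (hV : Continuous V) {φ : ℝ × ℝ → ℂ}
    (hφ : ContDiff ℝ ∞ φ) (hφc : HasCompactSupport φ) :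
    ∃ w ∈ hamiltonianMinGraph V, (w.1 : ℝ × ℝ → ℂ) =ᵐ[volume] φ ∧
      (w.2 : ℝ × ℝ → ℂ) =ᵐ[volume] hamiltonianExpr V φ := by
  have m1 : MemLp φ 2 (volume : Measure (ℝ × ℝ)) :=
    hφ.continuous.memLp_of_hasCompactSupport hφc
  have m2 : MemLp (hamiltonianExpr V φ) 2 (volume : Measure (ℝ × ℝ)) :=
    (continuous_hamiltonianExpr hV hφ).memLp_of_hasCompactSupport (hφc.hamiltonianExpr V)
  exact ⟨(m1.toLp, m2.toLp), ⟨φ, hφ, hφc, m1.coeFn_toLp, m2.coeFn_toLp⟩, m1.coeFn_toLp,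
    m2.coeFn_toLp⟩

/-- Closability follows from symmetry: the relation `⟪ψ, w.2⟫ = ⟪Hψ, w.1⟫` survives limits, and test
functions are total in `L²`. -/
lemma snd_eq_zero_of_mem_closure {V : ℝ × ℝ → ℝ} (hV : Continuous V) :
    ∀ w ∈ (hamiltonianMinGraph V).topologicalClosure, w.1 = 0 → w.2 = 0 := by
  intro w hw hw1
  refine eq_zero_of_forall_integral_test fun ψ hψ hψc => ?_
  obtain ⟨z, -, hz1, hz2⟩ := exists_mem_hamiltonianMinGraph hV hψ hψc
  have hclosed : IsClosed {w : L2Plane × L2Plane | ⟪z.1, w.2⟫_ℂ = ⟪z.2, w.1⟫_ℂ} :=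
    isClosed_eq (by fun_prop) (by fun_prop)
  have hsub : (hamiltonianMinGraph V : Set (L2Plane × L2Plane)) ⊆
      {w | ⟪z.1, w.2⟫_ℂ = ⟪z.2, w.1⟫_ℂ} := by
    rintro w ⟨φ, hφ, hφc, h1, h2⟩
    simp only [Set.mem_ofPred_eq]
    rw [inner_eq_integral_mul_conj hz1 h2, inner_eq_integral_mul_conj hz2 h1]
    exact integral_hamiltonianExpr_symm hV hφ hφc hψ hψc
  have h := closure_minimal hsub hclosed hw
  simp only [Set.mem_ofPred_eq] at h
  rw [hw1, inner_zero_right, inner_eq_integral_mul_conj hz1 (Filter.EventuallyEq.refl _ _)] at h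
  exact h

lemma dense_domain_hamiltonian {V : ℝ × ℝ → ℝ} (hV : Continuous V) :
    Dense ((hamiltonian V).domain : Set L2Plane) := by
  rw [Submodule.dense_iff_topologicalClosure_eq_top, Submodule.topologicalClosure_eq_top_iff,
    Submodule.eq_bot_iff]
  intro w hw
  refine eq_zero_of_forall_integral_test fun φ hφ hφc => ?_
  obtain ⟨z, hz, hz1, -⟩ := exists_mem_hamiltonianMinGraph hV hφ hφc
  have h := (Submodule.mem_orthogonal _ _).1 hw z.1
    ⟨z, (hamiltonianMinGraph V).le_topologicalClosure hz, rfl⟩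
  rwa [inner_eq_integral_mul_conj hz1 (Filter.EventuallyEq.refl _ _)] at h

/-- The `L²` norm of `u` over the set `S`. -/
noncomputable def normOn (S : Set (ℝ × ℝ)) (u : L2Plane) : ℝ :=
  ‖LpToLpRestrictCLM (ℝ × ℝ) ℂ ℂ volume 2 S u‖

lemma normOn_nonneg (S : Set (ℝ × ℝ)) (u : L2Plane) : 0 ≤ normOn S u := norm_nonneg _

lemma continuous_normOn (S : Set (ℝ × ℝ)) : Continuous (normOn S) :=
  (ContinuousLinearMap.continuous _).norm

lemma normOn_add_le (S : Set (ℝ × ℝ)) (u v : L2Plane) :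
    normOn S (u + v) ≤ normOn S u + normOn S v := by
  unfold normOn
  rw [map_add]
  exact norm_add_le _ _

lemma normOn_neg (S : Set (ℝ × ℝ)) (u : L2Plane) : normOn S (-u) = normOn S u := by
  unfold normOn
  rw [map_neg, norm_neg]

lemma normOn_sq_eq (S : Set (ℝ × ℝ)) (u : L2Plane) :
    normOn S u ^ 2 = ∫ p in S, ‖u p‖ ^ 2 := by
  rw [normOn, Lp_two_norm_sq]
  refine integral_congr_ae ?_
  filter_upwards [LpToLpRestrictCLM_coeFn ℂ S u] with p h
  rw [h]

lemma normOn_le (S : Set (ℝ × ℝ)) (u : L2Plane) : normOn S u ≤ ‖u‖ :=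
  norm_Lp_toLp_restrict_le S u

/-- Elements of the domain of `H` have controlled mass on thin strips. -/
lemma normOn_stripRegion_sq_le {V : ℝ × ℝ → ℝ} (hV : Continuous V) {A₀ : ℝ}
    (hVb : ∀ p, |V p| ≤ A₀) (β : ℝ) {ε δ : ℝ} (hε : 0 < ε) (hδ : 0 ≤ δ)
    {w : L2Plane × L2Plane} (hw : w ∈ (hamiltonianMinGraph V).topologicalClosure) :
    normOn (stripRegion β δ) w.1 ^ 2 ≤ (1 + ε) / 2 * normOn (stripRegion β (2 * δ)) w.1 ^ 2 +
      (1 + ε⁻¹) * (2 * δ ^ 2) * ((2 + A₀) * (‖w.2‖ ^ 2 + ‖w.1‖ ^ 2)) := by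
  have c1 := continuous_normOn (stripRegion β δ)
  have c2 := continuous_normOn (stripRegion β (2 * δ))
  -- Both sides are continuous in the graph norm, so the estimate need only be checked on test
  -- functions.
  have hclosed : IsClosed {w : L2Plane × L2Plane | normOn (stripRegion β δ) w.1 ^ 2 ≤
      (1 + ε) / 2 * normOn (stripRegion β (2 * δ)) w.1 ^ 2 +
      (1 + ε⁻¹) * (2 * δ ^ 2) * ((2 + A₀) * (‖w.2‖ ^ 2 + ‖w.1‖ ^ 2))} :=
    isClosed_le (by fun_prop) (by fun_prop)
  refine closure_minimal ?_ hclosed hw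
  rintro w ⟨φ, hφ, hφc, h1, h2⟩
  simp only [Set.mem_ofPred_eq]
  have hS : ∀ S, normOn S w.1 ^ 2 = ∫ p in S, ‖φ p‖ ^ 2 := by
    intro S
    rw [normOn_sq_eq]
    refine integral_congr_ae (ae_restrict_of_ae ?_)
    filter_upwards [h1] with p h
    rw [h]
  rw [hS, hS, norm_sq_eq_integral h1, norm_sq_eq_integral h2]
  refine (setIntegral_stripRegion_le hφ hφc β hε hδ).trans ?_
  gcongr
  exact integral_weight_Dy_sq_le hV hVb hφ hφc

end Closure

/-! ### Summing the recursion over dyadic strips. -/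

section StripSum

/-- Summing the recursion gives `S ≤ a 0 + q S + M` for a finite partial sum `S`, so `q S` can be
absorbed on the left. -/
lemma sum_range_le_of_recursion {a b : ℕ → ℝ} {q M : ℝ} (ha : ∀ j, 0 ≤ a j) (hb : ∀ j, 0 ≤ b j)
    (hq0 : 0 ≤ q) (hq1 : q < 1) (h : ∀ j, a (j + 1) ≤ q * a j + b (j + 1))
    (hM : ∀ J, ∑ j ∈ Finset.range J, b j ≤ M) (J : ℕ) :
    ∑ j ∈ Finset.range J, a j ≤ (a 0 + M) / (1 - q) := by
  have h1 : ∑ j ∈ Finset.range (J + 1), a j ≤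
      a 0 + q * ∑ j ∈ Finset.range (J + 1), a j + M := by
    have e1 := Finset.sum_range_succ' a J
    have e2 := Finset.sum_range_succ' b J
    have e3 : ∑ j ∈ Finset.range J, a (j + 1) ≤
        q * ∑ j ∈ Finset.range J, a j + ∑ j ∈ Finset.range J, b (j + 1) := by
      rw [Finset.mul_sum, ← Finset.sum_add_distrib]
      exact Finset.sum_le_sum fun j _ => h j
    have e4 : q * ∑ j ∈ Finset.range J, a j ≤ q * ∑ j ∈ Finset.range (J + 1), a j := by
      rw [Finset.sum_range_succ]
      exact mul_le_mul_of_nonneg_left (by linarith [ha J]) hq0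
    linarith [hM (J + 1), hb 0]
  rw [le_div_iff₀ (by linarith)]
  have h2 : ∑ j ∈ Finset.range J, a j ≤ ∑ j ∈ Finset.range (J + 1), a j := by
    rw [Finset.sum_range_succ]
    linarith [ha J]
  calc (∑ j ∈ Finset.range J, a j) * (1 - q) ≤ (∑ j ∈ Finset.range (J + 1), a j) * (1 - q) :=
        mul_le_mul_of_nonneg_right h2 (by linarith)
    _ ≤ a 0 + M := by linarith

lemma exists_pos_mul_one_add_pow_lt_one {θ : ℝ} (hθ0 : 0 ≤ θ) (hθ : θ < 1) :
    ∃ ε : ℝ, 0 < ε ∧ θ * (1 + ε) ^ 3 < 1 := by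
  refine ⟨(1 - θ) / 8, by linarith, ?_⟩
  set ε := (1 - θ) / 8 with hε
  have h1 : θ = 1 - 8 * ε := by rw [hε]; ring
  have h0 : 0 < ε := by rw [hε]; linarith
  have h2 : ε ≤ 1 := by linarith
  have h3 : (1 + ε) ^ 3 ≤ 1 + 7 * ε := by nlinarith [mul_pos h0 h0]
  calc θ * (1 + ε) ^ 3 ≤ θ * (1 + 7 * ε) := by gcongr
    _ < 1 := by rw [h1]; nlinarith

/-- One step of the comparison between consecutive dyadic strips, for a sum of an element of the
domain of `H` and a square integrable function. -/
lemma normOn_stripRegion_add_sq_le {V : ℝ × ℝ → ℝ} (hV : Continuous V) {A₀ : ℝ}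
    (hVb : ∀ p, |V p| ≤ A₀) (β : ℝ) {ε δ : ℝ} (hε : 0 < ε) (hδ : 0 ≤ δ)
    {v z : L2Plane} (hv : (v, z) ∈ (hamiltonianMinGraph V).topologicalClosure) (w : L2Plane) :
    normOn (stripRegion β δ) (v + w) ^ 2 ≤
      (1 + ε) ^ 3 / 2 * normOn (stripRegion β (2 * δ)) (v + w) ^ 2 +
      (1 + ε⁻¹) * (1 + ε) ^ 2 * (4 + 2 * A₀) *
        (‖w‖ ^ 2 + δ ^ 2 * (‖v‖ ^ 2 + ‖z‖ ^ 2)) := by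
  have hA0 : 0 ≤ A₀ := (abs_nonneg _).trans (hVb 0)
  have hc : 0 < 1 + ε⁻¹ := by positivity
  -- The three factors `1 + ε` come from replacing `v + w` by `v`, from the dilation estimate for
  -- `v`, and from returning to `v + w` on the wider strip.
  have h1 : normOn (stripRegion β δ) (v + w) ^ 2 ≤
      (1 + ε) * normOn (stripRegion β δ) v ^ 2 + (1 + ε⁻¹) * ‖w‖ ^ 2 := by
    refine le_trans ?_ (add_sq_le_of_pos hε _ _)
    exact pow_le_pow_left₀ (normOn_nonneg _ _)
      ((normOn_add_le _ v w).trans (by linarith [normOn_le (stripRegion β δ) w])) 2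
  have h2 : normOn (stripRegion β (2 * δ)) v ^ 2 ≤
      (1 + ε) * normOn (stripRegion β (2 * δ)) (v + w) ^ 2 + (1 + ε⁻¹) * ‖w‖ ^ 2 := by
    refine le_trans ?_ (add_sq_le_of_pos hε _ _)
    refine pow_le_pow_left₀ (normOn_nonneg _ _) ?_ 2
    have h := normOn_add_le (stripRegion β (2 * δ)) (v + w) (-w)
    rw [normOn_neg, add_neg_cancel_right] at h
    linarith [normOn_le (stripRegion β (2 * δ)) w]
  have h3 := normOn_stripRegion_sq_le hV hVb β hε hδ hv
  simp only at h3
  set c := 1 + ε⁻¹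
  set W := ‖w‖ ^ 2
  set N := ‖v‖ ^ 2 + ‖z‖ ^ 2
  have hW : 0 ≤ W := by positivity
  have hN : 0 ≤ N := by positivity
  set e := normOn (stripRegion β (2 * δ)) (v + w) ^ 2
  have h4 : normOn (stripRegion β δ) (v + w) ^ 2 ≤
      (1 + ε) * ((1 + ε) / 2 * ((1 + ε) * e + c * W) + c * (2 * δ ^ 2) * ((2 + A₀) * N)) +
        c * W := by
    refine h1.trans ?_
    gcongr
    refine h3.trans ?_
    rw [add_comm (‖z‖ ^ 2)]
    gcongr
  refine h4.trans ?_
  have h5 : c * (1 + ε) ^ 2 * (4 + 2 * A₀) * (W + δ ^ 2 * N) -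
      ((1 + ε) * ((1 + ε) / 2 * (c * W) + c * (2 * δ ^ 2) * ((2 + A₀) * N)) + c * W) =
      c * W * ((1 + ε) ^ 2 * (5 / 2 + 2 * A₀) + (ε ^ 2 + 2 * ε)) +
      c * (1 + ε) * ε * (4 + 2 * A₀) * (δ ^ 2 * N) := by ring
  have h6 : 0 ≤ c * W * ((1 + ε) ^ 2 * (5 / 2 + 2 * A₀) + (ε ^ 2 + 2 * ε)) +
      c * (1 + ε) * ε * (4 + 2 * A₀) * (δ ^ 2 * N) := by positivity
  linarith

/-- The dyadic square sum of the masses of `⟨H⟩^{-γ} u` on thin strips. -/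
lemma exists_japaneseNegPow_strip_sum {γ : ℝ} (hγ₀ : 0 < γ) (hγ₁ : γ < 1 / 2) {A₀ : ℝ}
    (hA₀ : 0 < A₀) :
    ∃ C : ℝ, 0 ≤ C ∧ ∀ V : ℝ × ℝ → ℝ, Continuous V → (∀ p, |V p| ≤ A₀) →
      ∃ B : L2Plane →L[ℂ] L2Plane, IsJapaneseNegPow (hamiltonian V) γ B ∧
        ∀ u, ‖B u‖ ^ 2 ≤ C * ‖u‖ ^ 2 ∧ ∀ β J, ∑ j ∈ Finset.range J, (4 : ℝ) ^ (j * γ) *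
          normOn (stripRegion β ((2 : ℝ)⁻¹ ^ j)) (B u) ^ 2 ≤ C * ‖u‖ ^ 2 := by
  have h4 : 1 < (4 : ℝ) ^ γ := Real.one_lt_rpow (by norm_num) hγ₀
  -- `ε` depends on `γ` alone and is fixed before `V`, which makes the final constant uniform over
  -- the potentials.
  obtain ⟨ε, hε, hq⟩ := exists_pos_mul_one_add_pow_lt_one (θ := (4 : ℝ) ^ γ / 2) (by positivity)
    (by linarith [four_rpow_lt_two hγ₁])
  set q := (4 : ℝ) ^ γ / 2 * (1 + ε) ^ 3
  have hq0 : 0 ≤ q := by positivity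
  set M := 9 / ((4 : ℝ) ^ γ - 1)
  have hM : 0 ≤ M := div_nonneg (by norm_num) (by linarith)
  set D := (1 + ε⁻¹) * (1 + ε) ^ 2 * (4 + 2 * A₀)
  have hD : 0 ≤ D := by positivity
  have hD' : 0 ≤ (2 * M + D * M) / (1 - q) := div_nonneg (by positivity) (by linarith)
  refine ⟨2 * M + (2 * M + D * M) / (1 - q), by positivity, fun V hV hVb => ?_⟩
  obtain ⟨B, hB, hBdec⟩ := exists_isJapaneseNegPow_decomposition hγ₀ hγ₁
    (hamiltonianMinGraph V).topologicalClosure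
    (hamiltonianMinGraph V).isClosed_topologicalClosure (snd_eq_zero_of_mem_closure hV)
    (dense_domain_hamiltonian hV)
  refine ⟨B, hB, fun u => ?_⟩
  obtain ⟨v, z, w, hz, hdec, hsum⟩ := hBdec u
  set U := B u
  let b : ℕ → ℝ := fun j => (4 : ℝ) ^ (j * γ) *
    (‖w j‖ ^ 2 + (4 : ℝ)⁻¹ ^ j * (‖v j‖ ^ 2 + ‖z j‖ ^ 2))
  have hbsum : ∀ J, ∑ j ∈ Finset.range J, b j ≤ M * ‖u‖ ^ 2 := hsum
  have hb0 : ∀ j, 0 ≤ b j := fun j => by positivity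
  have hU : ‖U‖ ^ 2 ≤ 2 * M * ‖u‖ ^ 2 := by
    -- The single term `j = 0` already bounds `‖v 0‖² + ‖w 0‖²`, hence `‖U‖²`.
    have h1 := hbsum 1
    simp only [b, Finset.sum_range_one, Nat.cast_zero, zero_mul, Real.rpow_zero, pow_zero,
      one_mul] at h1
    have h2 : ‖U‖ ≤ ‖v 0‖ + ‖w 0‖ := by
      rw [hdec 0]
      exact norm_add_le _ _
    have h3 : ‖U‖ ^ 2 ≤ (‖v 0‖ + ‖w 0‖) ^ 2 := by gcongr
    nlinarith [sq_nonneg (‖v 0‖ - ‖w 0‖), sq_nonneg ‖z 0‖]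
  have hu0 : 0 ≤ ‖u‖ ^ 2 := by positivity
  refine ⟨hU.trans ?_, fun β J => ?_⟩
  · nlinarith [mul_nonneg hD' hu0]
  let a : ℕ → ℝ := fun j => (4 : ℝ) ^ (j * γ) *
    normOn (stripRegion β ((2 : ℝ)⁻¹ ^ j)) U ^ 2
  have hstep : ∀ j, a (j + 1) ≤ q * a j + D * b (j + 1) := by
    intro j
    -- The same vector `U` is split differently at each scale; with this width, `δ²` equals the
    -- factor `4^{-(j+1)}` attached to `v (j+1)` and `z (j+1)` in the decomposition.
    have h := normOn_stripRegion_add_sq_le hV hVb β hε (δ := (2 : ℝ)⁻¹ ^ (j + 1)) (by positivity)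
      (hz (j + 1)) (w (j + 1))
    rw [← hdec (j + 1), show 2 * (2 : ℝ)⁻¹ ^ (j + 1) = 2⁻¹ ^ j by rw [pow_succ]; ring,
      show ((2 : ℝ)⁻¹ ^ (j + 1)) ^ 2 = 4⁻¹ ^ (j + 1) by rw [← pow_mul, mul_comm, pow_mul]; norm_num]
      at h
    have hpow : (4 : ℝ) ^ (((j + 1 : ℕ) : ℝ) * γ) = 4 ^ γ * 4 ^ (j * γ) := by
      rw [← Real.rpow_add (by norm_num)]
      congr 1
      push_cast
      ring
    calc a (j + 1) ≤ (4 : ℝ) ^ (((j + 1 : ℕ) : ℝ) * γ) * _ :=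
          mul_le_mul_of_nonneg_left h (by positivity)
      _ = q * a j + D * b (j + 1) := by
        rw [mul_add]
        simp only [a, b, q]
        rw [hpow]
        ring
  have hfin := sum_range_le_of_recursion (a := a) (b := fun j => D * b j) (M := D * (M * ‖u‖ ^ 2))
    (fun j => by positivity) (fun j => mul_nonneg hD (hb0 j)) hq0 hq hstep (fun J => by
      rw [← Finset.mul_sum]
      exact mul_le_mul_of_nonneg_left (hbsum J) hD) J
  have ha0 : a 0 ≤ 2 * M * ‖u‖ ^ 2 := by
    simp only [a, Nat.cast_zero, zero_mul, Real.rpow_zero, one_mul]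
    exact (pow_le_pow_left₀ (normOn_nonneg _ _) (normOn_le _ _) 2).trans hU
  refine hfin.trans ?_
  have h1q : 0 < 1 - q := by linarith
  calc (a 0 + D * (M * ‖u‖ ^ 2)) / (1 - q) ≤ (2 * M * ‖u‖ ^ 2 + D * (M * ‖u‖ ^ 2)) / (1 - q) := by
        gcongr
    _ = (2 * M + D * M) / (1 - q) * ‖u‖ ^ 2 := by ring
    _ ≤ _ := by
        gcongr
        linarith

end StripSum

/-! ### Dyadic control of the singular weight and the bounded operator. -/

section Weight

lemma measurable_singularWeight {F : ℝ → ℝ} (hF : IsCutoff F) (γ β η : ℝ) :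
    Measurable (singularWeight F γ β η) := by
  have h1 := hF.contDiff.continuous.measurable
  have h2 := continuous_japaneseBracket.measurable
  unfold singularWeight
  fun_prop

/-- The square of the weight is dominated by a dyadic sum of indicators of strips. -/
lemma singularWeight_sq_le {F : ℝ → ℝ} (hF : IsCutoff F) {γ : ℝ} (hγ₀ : 0 < γ) (hγ₁ : γ < 1 / 2)
    (β η : ℝ) (p : ℝ × ℝ) :
    singularWeight F γ β η p ^ 2 ≤ 1 ∨ ∃ j : ℕ, p ∈ stripRegion β ((2 : ℝ)⁻¹ ^ j) ∧
      singularWeight F γ β η p ^ 2 ≤ 2 * (4 : ℝ) ^ (j * γ) := by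
  by_cases hy : p.2 - β = 0
  · left
    -- On the line `y = β` the convention `0 ^ (-γ) = 0` makes the weight vanish.
    simp [singularWeight, hy, Real.zero_rpow (neg_ne_zero.2 hγ₀.ne')]
  have hJ := japaneseBracket_pos p.1
  have hs : 0 < Real.sqrt (japaneseBracket p.1) := Real.sqrt_pos.2 hJ
  set ρ := |p.2 - β| * Real.sqrt (japaneseBracket p.1) with hρ
  have hρ0 : 0 < ρ := mul_pos (abs_pos.2 hy) hs
  have hw : singularWeight F γ β η p ^ 2 ≤ (ρ ^ γ)⁻¹ ^ 2 := by
    have e : |p.2 - β| ^ (-γ) * japaneseBracket p.1 ^ (-(γ / 2)) = (ρ ^ γ)⁻¹ := by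
      rw [hρ, Real.mul_rpow (abs_nonneg _) hs.le, mul_inv, Real.rpow_neg (abs_nonneg _),
        Real.rpow_neg hJ.le, Real.sqrt_eq_rpow, ← Real.rpow_mul hJ.le]
      ring_nf
    have e2 : singularWeight F γ β η p = F ((p.2 - β) / η) * (ρ ^ γ)⁻¹ := by
      rw [← e, singularWeight]
      ring
    have h0 := hF.nonneg ((p.2 - β) / η)
    have h1 := hF.le_one ((p.2 - β) / η)
    rw [e2]
    have h2 : 0 ≤ (ρ ^ γ)⁻¹ := by positivity
    exact pow_le_pow_left₀ (mul_nonneg h0 h2) (mul_le_of_le_one_left h2 h1) 2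
  by_cases h1 : 1 ≤ ρ
  · left
    refine hw.trans (pow_le_one₀ (by positivity) (inv_le_one_of_one_le₀ ?_))
    exact Real.one_le_rpow h1 hγ₀.le
  · right
    -- Here `2^{-(j+1)} < ρ ≤ 2^{-j}`: the upper bound places `p` in the strip, the lower one gives
    -- `ρ^{-2γ} ≤ 4^{(j+1)γ}`, and the extra `4^γ` is below 2.
    obtain ⟨j, hj1, hj2⟩ := exists_nat_pow_near_of_lt_one hρ0 (le_of_not_ge h1)
      (y := (2 : ℝ)⁻¹) (by norm_num) (by norm_num)
    refine ⟨j, ?_, hw.trans ?_⟩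
    · change |p.2 - β| ≤ (2 : ℝ)⁻¹ ^ j * (Real.sqrt (japaneseBracket p.1))⁻¹
      rwa [← div_eq_mul_inv, le_div_iff₀ hs]
    · have h2 : ((2 : ℝ)⁻¹ ^ (j + 1)) ^ γ ≤ ρ ^ γ :=
        Real.rpow_le_rpow (by positivity) hj1.le hγ₀.le
      have h3 : (((2 : ℝ)⁻¹ ^ (j + 1)) ^ γ)⁻¹ ^ 2 = (4 : ℝ) ^ γ * 4 ^ (j * γ) := by
        rw [← Real.inv_rpow (by positivity), inv_pow, inv_inv, ← Real.rpow_natCast (_ ^ γ) 2,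
          ← Real.rpow_mul (by positivity), mul_comm γ, Real.rpow_mul (by positivity),
          Real.rpow_natCast, ← pow_mul, mul_comm (j + 1), pow_mul, Real.rpow_mul (by norm_num),
          Real.rpow_natCast, ← Real.mul_rpow (by norm_num) (by positivity), pow_succ']
        norm_num
      calc (ρ ^ γ)⁻¹ ^ 2 ≤ (((2 : ℝ)⁻¹ ^ (j + 1)) ^ γ)⁻¹ ^ 2 := by gcongr
        _ = (4 : ℝ) ^ γ * 4 ^ (j * γ) := h3
        _ ≤ 2 * 4 ^ (j * γ) := by
          gcongr
          exact (four_rpow_lt_two hγ₁).le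

lemma lintegral_normOn_sq (S : Set (ℝ × ℝ)) (u : L2Plane) :
    ∫⁻ p in S, ENNReal.ofReal (‖u p‖ ^ 2) = ENNReal.ofReal (normOn S u ^ 2) := by
  rw [normOn_sq_eq, ofReal_integral_eq_lintegral_ofReal]
  · exact ((memLp_two_iff_integrable_sq_norm (Lp.aestronglyMeasurable u)).1 (Lp.memLp u)).restrict
  · exact Filter.Eventually.of_forall fun p => by positivity

lemma lintegral_norm_sq (u : L2Plane) :
    ∫⁻ p, ENNReal.ofReal (‖u p‖ ^ 2) = ENNReal.ofReal (‖u‖ ^ 2) := by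
  rw [Lp_two_norm_sq, ofReal_integral_eq_lintegral_ofReal]
  · exact (memLp_two_iff_integrable_sq_norm (Lp.aestronglyMeasurable u)).1 (Lp.memLp u)
  · exact Filter.Eventually.of_forall fun p => by positivity

/-- The region where the weight is at most 1 costs `K` and the dyadic strips cost `2K`. With
extended nonnegative integrals, square integrability of the product is a conclusion rather than a
prerequisite. -/
lemma lintegral_singularWeight_sq_le {F : ℝ → ℝ} (hF : IsCutoff F) {γ : ℝ} (hγ₀ : 0 < γ)
    (hγ₁ : γ < 1 / 2) (β η : ℝ) (u : L2Plane) {K : ℝ} (hK : ‖u‖ ^ 2 ≤ K)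
    (hsum : ∀ J, ∑ j ∈ Finset.range J, (4 : ℝ) ^ (j * γ) *
      normOn (stripRegion β ((2 : ℝ)⁻¹ ^ j)) u ^ 2 ≤ K) :
    ∫⁻ p, ENNReal.ofReal (‖(singularWeight F γ β η p : ℂ) * u p‖ ^ 2) ≤
      ENNReal.ofReal (3 * K) := by
  have hK0 : 0 ≤ K := (sq_nonneg _).trans hK
  let S : ℕ → Set (ℝ × ℝ) := fun j => stripRegion β ((2 : ℝ)⁻¹ ^ j)
  have hS : ∀ j, MeasurableSet (S j) := fun j => measurableSet_stripRegion _ _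
  let N : ℝ × ℝ → ENNReal := fun p => ENNReal.ofReal (‖u p‖ ^ 2)
  have hN : AEMeasurable N := by
    have := (Lp.aestronglyMeasurable u).aemeasurable
    fun_prop
  let c : ℕ → ENNReal := fun j => ENNReal.ofReal (2 * (4 : ℝ) ^ (j * γ))
  have hpt : ∀ p, ENNReal.ofReal (‖(singularWeight F γ β η p : ℂ) * u p‖ ^ 2) ≤
      N p + ∑' j, c j * (S j).indicator N p := by
    intro p
    have e : ENNReal.ofReal (‖(singularWeight F γ β η p : ℂ) * u p‖ ^ 2) =
        ENNReal.ofReal (singularWeight F γ β η p ^ 2) * N p := by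
      rw [norm_mul, Complex.norm_real, mul_pow, Real.norm_eq_abs, sq_abs,
        ENNReal.ofReal_mul (sq_nonneg _)]
    rw [e]
    rcases singularWeight_sq_le hF hγ₀ hγ₁ β η p with h | ⟨j, hj, h⟩
    · refine le_trans ?_ le_self_add
      exact mul_le_of_le_one_left zero_le (ENNReal.ofReal_le_one.2 h)
    · refine le_trans ?_ le_add_self
      refine le_trans ?_ (ENNReal.le_tsum j)
      rw [Set.indicator_of_mem (by exact hj)]
      gcongr
      exact ENNReal.ofReal_le_ofReal h
  calc ∫⁻ p, ENNReal.ofReal (‖(singularWeight F γ β η p : ℂ) * u p‖ ^ 2)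
      ≤ ∫⁻ p, (N p + ∑' j, c j * (S j).indicator N p) := lintegral_mono hpt
    _ = (∫⁻ p, N p) + ∑' j, c j * ∫⁻ p in S j, N p := by
        rw [lintegral_add_left' hN, lintegral_tsum fun j => (hN.indicator (hS j)).const_mul _]
        congr 2 with j
        rw [lintegral_const_mul'' _ (hN.indicator (hS j)), lintegral_indicator (hS j)]
    _ ≤ ENNReal.ofReal K + ENNReal.ofReal (2 * K) := by
        refine add_le_add ?_ (ENNReal.tsum_le_of_sum_range_le fun J => ?_)
        · simp only [N]
          rw [lintegral_norm_sq]
          exact ENNReal.ofReal_le_ofReal hK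
        · simp only [N, c, lintegral_normOn_sq]
          simp only [← ENNReal.ofReal_mul (show (0 : ℝ) ≤ 2 * (4 : ℝ) ^ (_ : ℝ) by positivity)]
          rw [← ENNReal.ofReal_sum_of_nonneg fun j _ => by positivity]
          refine ENNReal.ofReal_le_ofReal ?_
          simp only [mul_assoc]
          rw [← Finset.mul_sum]
          exact mul_le_mul_of_nonneg_left (hsum J) zero_le_two
    _ = ENNReal.ofReal (3 * K) := by
        rw [← ENNReal.ofReal_add hK0 (by positivity)]
        congr 1
        ring

/-- A multiplication operator composed with a bounded operator is bounded as soon as it is bounded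
pointwise. -/
lemma exists_mul_comp_continuousLinearMap {W : ℝ × ℝ → ℝ} (hW : Measurable W)
    (B : L2Plane →L[ℂ] L2Plane) {K : ℝ} (hK : 0 ≤ K)
    (h : ∀ u, ∫⁻ p, ENNReal.ofReal (‖(W p : ℂ) * B u p‖ ^ 2) ≤ ENNReal.ofReal (K * ‖u‖ ^ 2)) :
    ∃ T : L2Plane →L[ℂ] L2Plane, ‖T‖ ≤ Real.sqrt K ∧
      ∀ u, (T u : ℝ × ℝ → ℂ) =ᵐ[volume] fun p => (W p : ℂ) * (B u : ℝ × ℝ → ℂ) p := by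
  have hm : ∀ u, AEStronglyMeasurable (fun p => (W p : ℂ) * B u p)
      (volume : Measure (ℝ × ℝ)) := fun u =>
    (Complex.measurable_ofReal.comp hW).aestronglyMeasurable.mul (Lp.aestronglyMeasurable _)
  -- Finiteness of the integral puts the range of `B` inside the domain of the multiplication
  -- operator, so the product is defined on all of `L²`.
  have hmem : ∀ u, MemLp (fun p => (W p : ℂ) * B u p) 2 (volume : Measure (ℝ × ℝ)) := by
    intro u
    rw [memLp_two_iff_integrable_sq_norm (hm u)]
    refine ⟨(hm u).norm.pow 2, ?_⟩
    rw [hasFiniteIntegral_iff_ofReal (Filter.Eventually.of_forall fun p => by positivity)]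
    exact (h u).trans_lt ENNReal.ofReal_lt_top
  let L : L2Plane →ₗ[ℂ] L2Plane :=
    { toFun := fun u => (hmem u).toLp
      map_add' := fun u v => by
        rw [← MemLp.toLp_add, MemLp.toLp_eq_toLp_iff, map_add]
        filter_upwards [Lp.coeFn_add (B u) (B v)] with p hp
        rw [hp]
        simp only [Pi.add_apply]
        ring
      map_smul' := fun c u => by
        rw [RingHom.id_apply, ← MemLp.toLp_const_smul, MemLp.toLp_eq_toLp_iff, map_smul]
        filter_upwards [Lp.coeFn_smul c (B u)] with p hp
        rw [hp]
        simp only [Pi.smul_apply, smul_eq_mul]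
        ring }
  have hL : ∀ u, (L u : ℝ × ℝ → ℂ) =ᵐ[volume] fun p => (W p : ℂ) * B u p :=
    fun u => (hmem u).coeFn_toLp
  have hbound : ∀ u, ‖L u‖ ≤ Real.sqrt K * ‖u‖ := by
    intro u
    rw [← abs_of_nonneg (norm_nonneg u), ← Real.sqrt_sq_eq_abs, ← Real.sqrt_mul hK]
    refine Real.le_sqrt_of_sq_le ?_
    rw [← ENNReal.ofReal_le_ofReal_iff (by positivity), ← lintegral_norm_sq]
    refine le_trans (le_of_eq (lintegral_congr_ae ?_)) (h u)
    filter_upwards [hL u] with p hp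
    rw [hp]
  exact ⟨L.mkContinuous _ hbound, L.mkContinuous_norm_le (Real.sqrt_nonneg _) hbound, hL⟩

end Weight

theorem proposition2p9 (γ : ℝ) (hγ₀ : 0 < γ) (hγ₁ : γ < 1 / 2) (F : ℝ → ℝ) (hF : IsCutoff F)
    (s A₀ A₁ : ℝ) (hs : 1 / 2 < s) (hA₀ : 0 < A₀) (hA₁ : 0 < A₁) :
    ∃ C : ℝ, ∀ V : ℝ × ℝ → ℝ, IsPotential s A₀ A₁ V →
      ∃ B : L2Plane →L[ℂ] L2Plane, IsJapaneseNegPow (hamiltonian V) γ B ∧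
        ∀ β η₀ : ℝ, 0 < η₀ → η₀ < 1 →
          ∃ T : L2Plane →L[ℂ] L2Plane, ‖T‖ ≤ C ∧
            ∀ u : L2Plane, (T u : ℝ × ℝ → ℂ) =ᵐ[volume]
              fun p => (singularWeight F γ β η₀ p : ℂ) * (B u : ℝ × ℝ → ℂ) p := by
  obtain ⟨C, hC, hmain⟩ := exists_japaneseNegPow_strip_sum hγ₀ hγ₁ hA₀
  refine ⟨Real.sqrt (3 * C), fun V hV => ?_⟩
  obtain ⟨B, hB, hBu⟩ := hmain V hV.continuous (hV.abs_le hs)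
  refine ⟨B, hB, fun β η₀ _ _ => ?_⟩
  refine exists_mul_comp_continuousLinearMap (measurable_singularWeight hF γ β η₀) B
    (by positivity) fun u => ?_
  rw [mul_assoc]
  exact lintegral_singularWeight_sq_le hF hγ₀ hγ₁ β η₀ (B u) (hBu u).1 ((hBu u).2 β)
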